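/- Let $N_B,T\ge 1$ be integers, $P_b>0$, $\sigma_u^2>0$, $0<\phi\le 1$, $0<\epsilon<1$. Let $\mathbf h_u,\mathbf e\sim\mathcal{CN}(0,\mathbf I_{N_B})$, the noise $n\sim\mathcal{CN}(0,\sigma_u^2)$ and the information signal $u$ be independent, let $\mathbf v=\overline{\mathbf h_u}/\|\mathbf h_u\|$ with $\mathbb E\|\mathbf v u\|^2=1$, and let the user receive $$y=\sqrt{P_b}\,\mathbf h_d\mathbf v u+n=\sqrt{P_b\phi}\,\|\mathbf h_u\|u+\tilde n,\qquad \mathbf h_d=\sqrt\phi\,\mathbf h_u^T+\sqrt{1-\phi}\,\mathbf e^T,\qquad \tilde n=\sqrt{P_b(1-\phi)}\,\mathbf e^T\mathbf v u+n .$$ Put $\gamma_u=P_b\phi\|\mathbf h_u\|^2/\mathrm{Var}(\tilde n)$, $C(\gamma)=\log_2(1+\gamma)$, $V(\gamma)=(\log_2 e)^2\bigl(1-(1+\gamma)^{-2}\bigr)$, let $Q^{-1}$ be the inverse of $Q(x)=\frac1{\sqrt{2\pi}}\int_x^\infty e^{-t^2/2}dt$, and let $$R_u=\mathbb E\Bigl[C(\gamma_u)-\sqrt{V(\gamma_u)/T}\;Q^{-1}(\epsilon)\Bigr]$$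 be the finite-blocklength lower bound on the downlink rate under uplink channel training. Put $\rho_b=P_b/\sigma_u^2$ and $\gamma=\gamma^u_{\rm eff}=\rho_b\phi/((1-\phi)\rho_b+1)$. Then $\gamma_u=\gamma\|\mathbf h_u\|^2$, all expectations below are finite, and, with $X\sim\mathrm{Gamma}(N_B,1)$: (1) $R_u=\Phi(\gamma,N_B)-D$, where exactly $$\Phi(\gamma,N_B)=\mathbb E[C(\gamma\|\mathbf h_u\|^2)]=\mathbb E[\log_2(1+\gamma X)]=\frac{e^{1/\gamma}}{\ln 2\;\Gamma(N_B)\,\gamma^{N_B}}\sum_{i=0}^{N_B-1}\binom{N_B-1}{i}(-1)^{N_B-1-i}\,G^{3,0}_{2,3}\!\left(\begin{matrix}-i,-i\\0,-1-i,-1-i\end{matrix}\,\middle|\,\frac1\gamma\right)$$ ($G$ is the Meijer G-function), and $D=\mathbb E\bigl[\sqrt{V(\gamma\|\mathbf h_u\|^2)/T}\bigr]Q^{-1}(\epsilon)=\mathbb E\bigl[\sqrt{V(\gamma X)/T}\bigr]Q^{-1}(\epsilon)$. (2) The leading-order Laplace approximation of $D$ for large $N_B$ is $$\Psi(\gamma,N_B,T)=\sqrt{\frac{2\pi}{T}}\,\frac{Q^{-1}(\epsilon)}{\Gamma(N_B)\ln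 2}\,e^{-(N_B-1)}(N_B-1)^{N_B-\frac12}\sqrt{1-\bigl(1+\gamma(N_B-1)\bigr)^{-2}},$$ so that $R_u\approx\Phi(\gamma,N_B)-\Psi(\gamma,N_B,T)$, in the following sense: there is an absolute constant $K$ (independent of all parameters) such that for all $N_B\ge 2$ $$|D-\Psi(\gamma,N_B,T)|\le\frac{K}{N_B-1}\,|\Psi(\gamma,N_B,T)|\quad\text{and}\quad |R_u-(\Phi(\gamma,N_B)-\Psi(\gamma,N_B,T))|\le\frac{K}{N_B-1}\,|\Psi(\gamma,N_B,T)| .$$ -/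

import Mathlib

open MeasureTheory ProbabilityTheory Real
open scoped NNReal

noncomputable section

namespace UplinkTraining

/-! ### The Meijer G-function -/

/-- The Mellin-Barnes integrand of `G^{m,n}_{p,q}(z | a; b)`. Mathlib's `Complex.Gamma` is `0` at
the poles of `Γ`, so a reciprocal of it is the entire function `1/Γ` everywhere. -/
def meijerGIntegrand (m n : ℕ) {p q : ℕ} (a : Fin p → ℂ) (b : Fin q → ℂ) (z s : ℂ) : ℂ :=
  ((∏ j : Fin q with j.val < m, Complex.Gamma (b j - s)) *
      (∏ j : Fin p with j.val < n, Complex.Gamma (1 - a j + s))) /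
    ((∏ j : Fin q with m ≤ j.val, Complex.Gamma (1 - b j + s)) *
      (∏ j : Fin p with n ≤ j.val, Complex.Gamma (a j - s))) * z ^ s

/-- The line `Re s = c` has the poles of `Γ(b_j - s)`, `j ≤ m`, on its right and the poles of
`Γ(1 - a_j + s)`, `j ≤ n`, on its left. -/
def IsSeparating (m n : ℕ) {p q : ℕ} (a : Fin p → ℂ) (b : Fin q → ℂ) (c : ℝ) : Prop :=
  (∀ j : Fin q, j.val < m → c < (b j).re) ∧ (∀ j : Fin p, j.val < n → (a j).re - 1 < c)

/-- `(1 / (2 π i)) ∫ f(s) ds` along the line `Re s = c`, from `c - i∞` to `c + i∞`, where `f` is the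
Mellin-Barnes integrand. -/
def meijerGLine (m n : ℕ) {p q : ℕ} (a : Fin p → ℂ) (b : Fin q → ℂ) (z : ℂ) (c : ℝ) : ℂ :=
  (1 / (2 * (π : ℂ))) * ∫ t : ℝ, meijerGIntegrand m n a b z ((c : ℂ) + (t : ℂ) * Complex.I)

open Classical in
/-- The Meijer G-function `G^{m,n}_{p,q}(z | a; b)` as a Mellin-Barnes integral along a vertical line
that separates the two families of poles. This is the standard definition if such a line exists (for
`n = 0` it always does), `p + q < 2 (m + n)` and `|arg z| < (m + n - (p + q) / 2) π`; by Cauchy's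
theorem the choice of the line does not matter. Parameters without a separating line are not used
and get the value `0`. -/
def meijerG (m n : ℕ) {p q : ℕ} (a : Fin p → ℂ) (b : Fin q → ℂ) (z : ℂ) : ℂ :=
  if h : ∃ c : ℝ, IsSeparating m n a b c then meijerGLine m n a b z h.choose else 0

/-! ### Finite-blocklength quantities -/

/-- The Gaussian tail function `Q(x) = P(Z > x)`, `Z` standard normal. -/
def Qfun (x : ℝ) : ℝ := (gaussianReal 0 1).real (Set.Ioi x)

/-- The inverse of `Q`, a strictly decreasing bijection from `ℝ` onto `(0,1)`. -/
def Qinv (ε : ℝ) : ℝ := Function.invFun Qfun ε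

/-- The channel capacity `C(γ) = log₂ (1 + γ)`. -/
def capacity (γ : ℝ) : ℝ := Real.logb 2 (1 + γ)

/-- The channel dispersion `V(γ) = (log₂ e)² (1 - (1 + γ)⁻²)`. -/
def dispersion (γ : ℝ) : ℝ := (Real.logb 2 (Real.exp 1)) ^ 2 * (1 - ((1 + γ) ^ 2)⁻¹)

/-- The rate loss `√(V(γ) / T) Q⁻¹(ε)` at blocklength `T` and error probability `ε`. -/
def rateLoss (T : ℕ) (ε γ : ℝ) : ℝ := √(1 / (T : ℝ) * dispersion γ) * Qinv ε

/-! ### The system model -/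

/-- The law `CN(0, v)` on `ℂ`: independent real and imaginary parts, both `N(0, v/2)`. -/
def complexGaussian (v : ℝ≥0) : Measure ℂ :=
  ((gaussianReal 0 (v / 2)).prod (gaussianReal 0 (v / 2))).map
    (fun p : ℝ × ℝ => (p.1 : ℂ) + (p.2 : ℂ) * Complex.I)

/-- The law `CN(0, I_N)` on `ℂ^N`: i.i.d. entries with law `CN(0, 1)`. -/
def complexGaussianVec (N : ℕ) : Measure (EuclideanSpace ℂ (Fin N)) :=
  (Measure.pi (fun _ : Fin N => complexGaussian 1)).map (WithLp.toLp 2)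

/-- The product `gᵀ w` of a row and a column vector (no complex conjugation). -/
def rowMul {N : ℕ} (g w : EuclideanSpace ℂ (Fin N)) : ℂ := ∑ j, g j * w j

/-- The normalized beamforming vector matched to the channel `h`, for which `hᵀ v = ‖h‖`. -/
def beamformer {N : ℕ} (h : EuclideanSpace ℂ (Fin N)) : EuclideanSpace ℂ (Fin N) :=
  ((‖h‖⁻¹ : ℝ) : ℂ) • WithLp.toLp 2 (fun j => (starRingEnd ℂ) (h j))

/-- The downlink channel `√φ h_u + √(1-φ) e`. -/
def downlink {N : ℕ} (φ : ℝ) (hu e : EuclideanSpace ℂ (Fin N)) : EuclideanSpace ℂ (Fin N) :=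
  ((√φ : ℝ) : ℂ) • hu + ((√(1 - φ) : ℝ) : ℂ) • e

/-- The received signal `√P h_dᵀ x + n`, where `x = v u`. -/
def received {N : ℕ} (P φ : ℝ) (hu e : EuclideanSpace ℂ (Fin N)) (u n : ℂ) : ℂ :=
  ((√P : ℝ) : ℂ) * rowMul (downlink φ hu e) (u • beamformer hu) + n

/-- The interference plus noise `√(P (1-φ)) eᵀ v u + n`. -/
def effNoise {N : ℕ} (P φ : ℝ) (hu e : EuclideanSpace ℂ (Fin N)) (u n : ℂ) : ℂ :=
  ((√(P * (1 - φ)) : ℝ) : ℂ) * rowMul e (beamformer hu) * u + n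

theorem rowMul_beamformer {N : ℕ} (h : EuclideanSpace ℂ (Fin N)) :
    rowMul h (beamformer h) = ((‖h‖ : ℝ) : ℂ) := by
  have h1 : rowMul h (beamformer h) = ((‖h‖⁻¹ : ℝ) : ℂ) * ((‖h‖ ^ 2 : ℝ) : ℂ) := by
    rw [EuclideanSpace.norm_sq_eq]
    push_cast
    rw [Finset.mul_sum]
    refine Finset.sum_congr rfl fun j _ => ?_
    rw [← Complex.mul_conj']
    simp [beamformer]
    ring
  rw [h1, ← Complex.ofReal_mul]
  congr 1
  rcases eq_or_ne ‖h‖ 0 with h0 | h0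
  · simp [h0]
  · field_simp

/-- The received signal is the useful part `√(P φ) ‖h_u‖ u` plus the interference and noise. -/
theorem received_eq {N : ℕ} {P φ : ℝ} (hP : 0 ≤ P) (hu e : EuclideanSpace ℂ (Fin N)) (u n : ℂ) :
    received P φ hu e u n =
      ((√(P * φ) : ℝ) : ℂ) * ((‖hu‖ : ℝ) : ℂ) * u + effNoise P φ hu e u n := by
  have h1 : rowMul (downlink φ hu e) (u • beamformer hu) =
      ((√φ : ℝ) : ℂ) * rowMul hu (beamformer hu) * u +
        ((√(1 - φ) : ℝ) : ℂ) * rowMul e (beamformer hu) * u := by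
    simp only [rowMul, downlink, Finset.mul_sum, Finset.sum_mul, ← Finset.sum_add_distrib]
    refine Finset.sum_congr rfl fun j _ => ?_
    simp
    ring
  rw [received, effNoise, h1, rowMul_beamformer, Real.sqrt_mul hP, Real.sqrt_mul hP]
  push_cast
  ring

/-- The variance `E|X - E X|²` of a complex random variable. -/
def complexVar {Ω : Type*} [MeasurableSpace Ω] (μ : Measure Ω) (X : Ω → ℂ) : ℝ :=
  ∫ ω, ‖X ω - ∫ ω', X ω' ∂μ‖ ^ 2 ∂μ

/-- The system: uplink channel `hu` and uncertain part `e` with law `CN(0, I_N)`, noise `n` with law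
`CN(0, σ2)`, information signal `u` for which the transmitted signal `u v` has unit average power;
`hu`, `e`, `u`, `n` are (mutually) independent. -/
structure IsUplinkModel {Ω : Type*} [MeasurableSpace Ω] {N : ℕ} (μ : Measure Ω) (σ2 : ℝ≥0)
    (hu e : Ω → EuclideanSpace ℂ (Fin N)) (u n : Ω → ℂ) : Prop where
  hu_law : HasLaw hu (complexGaussianVec N) μ
  e_law : HasLaw e (complexGaussianVec N) μ
  n_law : HasLaw n (complexGaussian σ2) μ
  u_meas : AEMeasurable u μ
  power : ∫ ω, ‖u ω • beamformer (hu ω)‖ ^ 2 ∂μ = 1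
  indep_hu_e : IndepFun hu e μ
  indep_u : IndepFun (fun ω => (hu ω, e ω)) u μ
  indep_n : IndepFun (fun ω => (hu ω, e ω, u ω)) n μ

/-- The variance of the interference plus noise. -/
def effNoiseVar {Ω : Type*} [MeasurableSpace Ω] {N : ℕ} (μ : Measure Ω) (P φ : ℝ)
    (hu e : Ω → EuclideanSpace ℂ (Fin N)) (u n : Ω → ℂ) : ℝ :=
  complexVar μ (fun ω => effNoise P φ (hu ω) (e ω) (u ω) (n ω))

/-- The SINR `γ_u = P φ ‖h_u‖² / Var(interference plus noise)` at the user. -/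
def sinr {Ω : Type*} [MeasurableSpace Ω] {N : ℕ} (μ : Measure Ω) (P φ : ℝ)
    (hu e : Ω → EuclideanSpace ℂ (Fin N)) (u n : Ω → ℂ) (ω : Ω) : ℝ :=
  P * φ * ‖hu ω‖ ^ 2 / effNoiseVar μ P φ hu e u n

/-- The lower bound `R_u = E[C(γ_u) - √(V(γ_u) / T) Q⁻¹(ε)]` on the downlink data rate. -/
def rateUplink {Ω : Type*} [MeasurableSpace Ω] {N : ℕ} (μ : Measure Ω) (P φ : ℝ)
    (hu e : Ω → EuclideanSpace ℂ (Fin N)) (u n : Ω → ℂ) (T : ℕ) (ε : ℝ) : ℝ :=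
  ∫ ω, (capacity (sinr μ P φ hu e u n ω) - rateLoss T ε (sinr μ P φ hu e u n ω)) ∂μ

/-- The effective SNR `ρ φ / ((1 - φ) ρ + 1)`. -/
def effSNR (ρ φ : ℝ) : ℝ := ρ * φ / ((1 - φ) * ρ + 1)

/-! ### The closed forms -/

/-- The closed form `Φ(γ, N)` of the capacity term. -/
def Phi (γ : ℝ) (N : ℕ) : ℂ :=
  ((Real.exp (1 / γ) / (Real.log 2 * Real.Gamma N * γ ^ N) : ℝ) : ℂ) *
    ∑ i ∈ Finset.range N, ((N - 1).choose i : ℂ) * (-1) ^ (N - 1 - i) *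
      meijerG 3 0 ![-(i : ℂ), -(i : ℂ)] ![0, -1 - (i : ℂ), -1 - (i : ℂ)] ((1 / γ : ℝ) : ℂ)

/-- The Laplace-method closed form `Ψ(γ, N, T)` of the dispersion term. -/
def Psi (γ : ℝ) (N T : ℕ) (ε : ℝ) : ℝ :=
  √(2 * π / T) * (Qinv ε / (Real.Gamma N * Real.log 2)) * Real.exp (-((N : ℝ) - 1)) *
    ((N : ℝ) - 1) ^ ((N : ℝ) - 1 / 2) * √(1 - ((1 + γ * ((N : ℝ) - 1)) ^ 2)⁻¹)

end UplinkTraining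

end

namespace UplinkTraining

/-! ### Stirling's formula with a relative error bound -/

/-! Given the uplink channel, the interference `eᵀ v` has mean zero and second moment `‖v‖² = 1`.
Independence and the power constraint then give the effective noise variance `P (1 - φ) + σ2`, so
the SINR is `γ ‖h_u‖²` (`effNoiseVar_eq`, `sinr_eq`). Comparing characteristic functions shows
`‖h_u‖² ~ Gamma(N, 1)` (`hasLaw_normSq_complexGaussianVec`), and both terms of the rate become
one-dimensional integrals.

Capacity term: the substitution `t = 1 + γ x` turns `E log (1 + γ X)` into a multiple of the
integral over `t > 1` of `(t - 1)^(N-1) log t e^(-t/γ)`. The binomial theorem splits it into the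
Laplace integrals `logLaplace i (1/γ)`. The Mellin transform of `logLaplace i` is `Γ(w) / (w - i -
1)²`, which at `w = -s` is the quotient of Gamma functions in the Mellin-Barnes integrand. Mellin
inversion therefore identifies each integral with its Meijer G-function (`meijerG_log`).

Dispersion term: put `n = N - 1`, the mode of the Gamma density `x^n e^(-x) / n!`. Up to a common
factor, `D` is `E √(1 - (1 + γ X)⁻²)`, while `Ψ` is the value `M` of this root at `X = n` times the
Stirling ratio `S = √(2 π n) (n/e)^n / n!`. Relative to `M`, the root lies between two quadratics in
`X/n - 1` whose coefficients are bounded uniformly in `γ` (`sqrt_normDispersion_mul_bounds`). As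
`X/n - 1` has first and second moments of order `1/n`, the mean is `M (1 + O(1/n))`. Stirling's
formula gives `S = 1 + O(1/n)`, with explicit constants. No analysis of tails is needed. -/

theorem stirlingSeq_le_sqrt_pi_mul_exp {n : ℕ} (hn : n ≠ 0) :
    Stirling.stirlingSeq n ≤ √π * Real.exp (1 / (12 * n)) := by
  have hpos : ∀ k : ℕ, 0 < Stirling.stirlingSeq (k + 1) := Stirling.stirlingSeq'_pos
  -- The decrements of `log stirlingSeq` are at most `1 / (12 n (n + 1))`, which telescopes to `1 /
  -- (12 n)`. The corrected sequence increases to `log √π`, so each of its terms is at most that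
  -- limit.
  have hmono : Monotone fun k : ℕ =>
      Real.log (Stirling.stirlingSeq (k + 1)) - 1 / (12 * ((k : ℝ) + 1)) := by
    refine monotone_nat_of_le_succ fun k => ?_
    have h := Stirling.log_stirlingSeq_sdiff_le (k + 1)
    have h2 : (1 : ℝ) / (12 * ((k + 1 : ℕ) : ℝ) * (((k + 1 : ℕ) : ℝ) + 1)) =
        1 / (12 * ((k : ℝ) + 1)) - 1 / (12 * (((k + 1 : ℕ) : ℝ) + 1)) := by
      push_cast
      field_simp
      ring
    rw [h2] at h
    linarith
  have hlim : Filter.Tendsto (fun k : ℕ =>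
      Real.log (Stirling.stirlingSeq (k + 1)) - 1 / (12 * ((k : ℝ) + 1))) Filter.atTop
      (nhds (Real.log √π - 0)) := by
    refine Filter.Tendsto.sub ?_ ?_
    · exact ((Stirling.tendsto_stirlingSeq_sqrt_pi.comp (Filter.tendsto_add_atTop_nat 1)).log
        (by positivity))
    · have h := (tendsto_one_div_add_atTop_nhds_zero_nat (𝕜 := ℝ)).const_mul (1 / 12)
      simp only [mul_zero] at h
      refine h.congr fun k => ?_
      field_simp
  obtain ⟨k, rfl⟩ := Nat.exists_eq_succ_of_ne_zero hn
  have h := hmono.ge_of_tendsto hlim k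
  simp only [sub_zero] at h
  rw [← Real.log_le_log_iff (hpos k) (by positivity), Real.log_mul (by positivity) (by positivity),
    Real.log_exp]
  push_cast
  linarith

theorem stirling_ratio_bounds {n : ℕ} (hn : n ≠ 0) :
    1 - 1 / (12 * (n : ℝ)) ≤ √(2 * π * n) * (n / Real.exp 1) ^ n / n.factorial ∧
      √(2 * π * n) * (n / Real.exp 1) ^ n / n.factorial ≤ 1 := by
  have hf : (0 : ℝ) < n.factorial := by positivity
  refine ⟨?_, (div_le_one hf).2 (Stirling.le_factorial_stirling n)⟩
  have hn' : (0 : ℝ) < n := by positivity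
  have h := stirlingSeq_le_sqrt_pi_mul_exp hn
  rw [Stirling.stirlingSeq, div_le_iff₀ (by positivity)] at h
  have hs : √(2 * π * n) = √π * √(2 * n) := by
    rw [← Real.sqrt_mul pi_pos.le]
    congr 1
    ring
  have h1 : (n.factorial : ℝ) * Real.exp (-(1 / (12 * n))) ≤
      √(2 * π * n) * (n / Real.exp 1) ^ n := by
    rw [Real.exp_neg, ← div_eq_mul_inv, div_le_iff₀ (by positivity), hs]
    linarith
  rw [le_div_iff₀ hf]
  have h2 := Real.add_one_le_exp (-(1 / (12 * (n : ℝ))))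
  nlinarith

/-! ### The square root of the normalized dispersion -/

/-- The normalized dispersion `1 - (1 + y)⁻²`. -/
noncomputable def normDispersion (y : ℝ) : ℝ := 1 - ((1 + y) ^ 2)⁻¹

theorem normDispersion_nonneg {y : ℝ} (hy : 0 ≤ y) : 0 ≤ normDispersion y := by
  have : ((1 + y) ^ 2)⁻¹ ≤ 1 := inv_le_one_of_one_le₀ (by nlinarith)
  unfold normDispersion
  linarith

theorem normDispersion_pos {y : ℝ} (hy : 0 < y) : 0 < normDispersion y := by
  have : ((1 + y) ^ 2)⁻¹ < 1 := inv_lt_one_of_one_lt₀ (by nlinarith)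
  unfold normDispersion
  linarith

theorem normDispersion_le_one (y : ℝ) : normDispersion y ≤ 1 := by
  have : 0 ≤ ((1 + y) ^ 2)⁻¹ := by positivity
  unfold normDispersion
  linarith

theorem measurable_normDispersion : Measurable normDispersion := by
  unfold normDispersion
  fun_prop

theorem normDispersion_mul_sub {y r : ℝ} (hy : 0 < y) (hr : 0 ≤ r) :
    normDispersion (y * r) / normDispersion y - 1 =
      (r - 1) * (2 + y + y * r) / ((2 + y) * (1 + y * r) ^ 2) := by
  have h0 : normDispersion y = y * (2 + y) / (1 + y) ^ 2 := by
    unfold normDispersion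
    field_simp
    ring
  have h1 : 0 < 1 + y * r := by positivity
  have h2 : normDispersion (y * r) = y * r * (2 + y * r) / (1 + y * r) ^ 2 := by
    unfold normDispersion
    field_simp
    ring
  rw [h0, h2]
  field_simp
  ring

theorem one_add_sub_le_sqrt {q : ℝ} (hq : 0 ≤ q) :
    1 + (q - 1) / 2 - (q - 1) ^ 2 / 2 ≤ √q := by
  obtain ⟨s, hs, rfl⟩ : ∃ s : ℝ, 0 ≤ s ∧ q = s ^ 2 := ⟨√q, by positivity, by rw [Real.sq_sqrt hq]⟩
  rw [Real.sqrt_sq hs]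
  have : s - (1 + (s ^ 2 - 1) / 2 - (s ^ 2 - 1) ^ 2 / 2) = (s - 1) ^ 2 / 2 * (s * (s + 2)) := by
    ring
  have : 0 ≤ (s - 1) ^ 2 / 2 * (s * (s + 2)) := by positivity
  linarith

/-- A two-sided quadratic bound at `r = 1` for `√(1 - (1 + y r)⁻²)`, relative to its value there. -/
theorem sqrt_normDispersion_mul_bounds {y : ℝ} (hy : 0 < y) :
    ∃ a : ℝ, 0 ≤ a ∧ a ≤ 1 ∧ ∀ r : ℝ, 0 ≤ r →
      (1 + a * (r - 1) - 2 * (r - 1) ^ 2) * √(normDispersion y) ≤ √(normDispersion (y * r)) ∧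
        √(normDispersion (y * r)) ≤ (1 + a * (r - 1)) * √(normDispersion y) := by
  -- The slope `a` is the derivative at `r = 1` of the square root of the quotient `q` below.
  refine ⟨1 / ((2 + y) * (1 + y)), by positivity, ?_, fun r hr => ?_⟩
  · rw [div_le_one (by positivity)]
    nlinarith
  set A : ℝ := 1 / ((2 + y) * (1 + y)) with hA
  have hp := normDispersion_pos hy
  have hyr : 0 ≤ y * r := by positivity
  set q := normDispersion (y * r) / normDispersion y with hq
  have hq0 : 0 ≤ q := div_nonneg (normDispersion_nonneg hyr) hp.le
  have hqe : √(normDispersion (y * r)) = √q * √(normDispersion y) := by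
    rw [← Real.sqrt_mul hq0, hq, div_mul_cancel₀ _ hp.ne']
  have hq1 : q - 1 = (r - 1) * ((2 + y + y * r) / ((2 + y) * (1 + y * r) ^ 2)) := by
    rw [hq, normDispersion_mul_sub hy hr, mul_div_assoc]
  have hb : (0 : ℝ) < 1 + y * r := by positivity
  have hfac0 : 0 ≤ (2 + y + y * r) / ((2 + y) * (1 + y * r) ^ 2) := by positivity
  have hfac1 : (2 + y + y * r) / ((2 + y) * (1 + y * r) ^ 2) ≤ 1 := by
    rw [div_le_one (by positivity)]
    nlinarith [mul_nonneg hyr hy.le, mul_nonneg hyr hyr, mul_nonneg hy.le (mul_nonneg hyr hyr)]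
  have hsq : (q - 1) ^ 2 ≤ (r - 1) ^ 2 := by
    rw [hq1, mul_pow]
    exact mul_le_of_le_one_right (sq_nonneg _) (pow_le_one₀ hfac0 hfac1)
  -- Exact first-order expansion of `q` at `r = 1`. Its remainder coefficient lies in `[0, 3]` for
  -- all `y` and `r`, which makes the final bounds uniform.
  have hrem : q - 1 = 2 * A * (r - 1) -
      (r - 1) ^ 2 * (y * (3 + y + 2 * (y * r)) / ((2 + y) * (1 + y * r) ^ 2 * (1 + y))) := by
    rw [hq1, hA]
    field_simp
    ring
  have hrem0 : 0 ≤ y * (3 + y + 2 * (y * r)) / ((2 + y) * (1 + y * r) ^ 2 * (1 + y)) := by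
    positivity
  have hrem3 : y * (3 + y + 2 * (y * r)) / ((2 + y) * (1 + y * r) ^ 2 * (1 + y)) ≤ 3 := by
    rw [div_le_iff₀ (by positivity)]
    have e1 : y * (3 + y + 2 * (y * r)) ≤ (2 + y) * (3 * (1 + y) * (1 + y * r)) := by
      have : 3 + y + 2 * (y * r) ≤ 3 * (1 + y) * (1 + y * r) := by
        nlinarith [mul_nonneg hyr hy.le]
      exact mul_le_mul (by linarith) this (by positivity) (by positivity)
    have e2 : (1 + y * r) ≤ (1 + y * r) ^ 2 := by nlinarith
    have e3 : (2 + y) * (3 * (1 + y) * (1 + y * r)) ≤ (2 + y) * (3 * (1 + y) * (1 + y * r) ^ 2) := by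
      gcongr
    linarith
  have hlo := one_add_sub_le_sqrt hq0
  have hup : √q ≤ 1 + (q - 1) / 2 := by
    nlinarith [sq_nonneg (√q - 1), Real.sq_sqrt hq0]
  have hr2 := sq_nonneg (r - 1)
  rw [hqe]
  refine ⟨mul_le_mul_of_nonneg_right ?_ (Real.sqrt_nonneg _),
    mul_le_mul_of_nonneg_right ?_ (Real.sqrt_nonneg _)⟩
  -- The coefficient 2 is `3/2 + 1/2`: half the remainder bound 3, plus the term `(q - 1)² / 2 ≤ (r
  -- - 1)² / 2`.
  · nlinarith [mul_le_mul_of_nonneg_left hrem3 hr2]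
  · nlinarith [mul_nonneg hr2 hrem0]

/-! ### Integration against a Gamma law with integer shape -/

theorem gammaMeasure_nat_succ (n : ℕ) :
    gammaMeasure ((n + 1 : ℕ) : ℝ) 1 = (volume.restrict (Set.Ioi 0)).withDensity
      fun x => ENNReal.ofReal (x ^ n * Real.exp (-x) / n.factorial) := by
  rw [gammaMeasure, ← withDensity_indicator measurableSet_Ioi]
  refine withDensity_congr_ae ?_
  -- At `x = 0` the two densities differ when `n = 0`; a single point is null.
  have h0 : ∀ᵐ x : ℝ, x ≠ 0 := by simp [ae_iff]
  filter_upwards [h0] with x hx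
  rcases lt_or_gt_of_ne hx with h | h
  · rw [gammaPDF_of_neg h, Set.indicator_of_notMem (by simpa using h.le)]
  · rw [gammaPDF_of_nonneg h.le, Set.indicator_of_mem (by simpa using h)]
    congr 1
    rw [Nat.cast_add_one, add_sub_cancel_right, Real.rpow_natCast, Real.Gamma_nat_eq_factorial]
    simp
    ring

theorem integral_gammaMeasure_nat_succ {E : Type*} [NormedAddCommGroup E] [NormedSpace ℝ E]
    (n : ℕ) (f : ℝ → E) :
    ∫ x, f x ∂gammaMeasure ((n + 1 : ℕ) : ℝ) 1 =
      ∫ x in Set.Ioi (0 : ℝ), (x ^ n * Real.exp (-x) / n.factorial) • f x := by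
  rw [gammaMeasure_nat_succ, integral_withDensity_eq_integral_toReal_smul (by fun_prop)
    (Filter.Eventually.of_forall fun _ => ENNReal.ofReal_lt_top)]
  refine setIntegral_congr_fun measurableSet_Ioi fun x hx => ?_
  have hx : (0 : ℝ) < x := hx
  rw [ENNReal.toReal_ofReal (by positivity)]

theorem integrable_gammaMeasure_nat_succ_iff {E : Type*} [NormedAddCommGroup E] [NormedSpace ℝ E]
    (n : ℕ) (f : ℝ → E) :
    Integrable f (gammaMeasure ((n + 1 : ℕ) : ℝ) 1) ↔
      IntegrableOn (fun x => (x ^ n * Real.exp (-x) / n.factorial) • f x) (Set.Ioi 0) := by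
  rw [gammaMeasure_nat_succ, integrable_withDensity_iff_integrable_smul' (by fun_prop)
    (Filter.Eventually.of_forall fun _ => ENNReal.ofReal_lt_top)]
  refine integrableOn_congr_fun (fun x hx => ?_) measurableSet_Ioi
  have hx : (0 : ℝ) < x := hx
  rw [ENNReal.toReal_ofReal (by positivity)]

theorem ae_gammaMeasure_pos (n : ℕ) : ∀ᵐ x ∂gammaMeasure ((n + 1 : ℕ) : ℝ) 1, 0 < x := by
  rw [gammaMeasure_nat_succ]
  exact (withDensity_absolutelyContinuous _ _).ae_le (ae_restrict_mem measurableSet_Ioi)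

theorem integrableOn_pow_mul_exp_neg (n : ℕ) :
    IntegrableOn (fun x : ℝ => x ^ n * Real.exp (-x)) (Set.Ioi 0) := by
  have h := Real.GammaIntegral_convergent (s := (n : ℝ) + 1) (by positivity)
  refine h.congr_fun (fun x _ => ?_) measurableSet_Ioi
  simp [Real.rpow_natCast, mul_comm]

theorem integral_pow_mul_exp_neg (n : ℕ) :
    ∫ x in Set.Ioi (0 : ℝ), x ^ n * Real.exp (-x) = n.factorial := by
  rw [← Real.Gamma_nat_eq_factorial, Real.Gamma_eq_integral (by positivity)]
  refine setIntegral_congr_fun measurableSet_Ioi fun x _ => ?_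
  simp [Real.rpow_natCast, mul_comm]

theorem integrable_pow_gammaMeasure (n k : ℕ) :
    Integrable (fun x : ℝ => x ^ k) (gammaMeasure ((n + 1 : ℕ) : ℝ) 1) := by
  rw [integrable_gammaMeasure_nat_succ_iff]
  refine IntegrableOn.congr_fun ((integrableOn_pow_mul_exp_neg (n + k)).div_const n.factorial)
    (fun x _ => ?_) measurableSet_Ioi
  simp only [smul_eq_mul]
  ring

theorem integral_pow_gammaMeasure (n k : ℕ) :
    ∫ x, x ^ k ∂gammaMeasure ((n + 1 : ℕ) : ℝ) 1 = (n + k).factorial / n.factorial := by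
  rw [integral_gammaMeasure_nat_succ, ← integral_pow_mul_exp_neg (n + k), ← integral_div]
  refine setIntegral_congr_fun measurableSet_Ioi fun x _ => ?_
  simp only [smul_eq_mul]
  ring

theorem isProbabilityMeasure_gammaMeasure_nat_succ (n : ℕ) :
    IsProbabilityMeasure (gammaMeasure ((n + 1 : ℕ) : ℝ) 1) :=
  isProbabilityMeasure_gammaMeasure (by positivity) one_pos

theorem integral_quadratic_gammaMeasure {n : ℕ} (hn : n ≠ 0) (a b : ℝ) :
    Integrable (fun x : ℝ => 1 + a * (x / n - 1) - b * (x / n - 1) ^ 2)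
      (gammaMeasure ((n + 1 : ℕ) : ℝ) 1) ∧
    ∫ x, (1 + a * (x / n - 1) - b * (x / n - 1) ^ 2) ∂gammaMeasure ((n + 1 : ℕ) : ℝ) 1 =
      1 + a / n - b * (n + 2) / n ^ 2 := by
  have hn' : (n : ℝ) ≠ 0 := by exact_mod_cast hn
  have e : (fun x : ℝ => 1 + a * (x / n - 1) - b * (x / n - 1) ^ 2) = fun x : ℝ =>
      (1 - a - b) * x ^ 0 + (a / n + 2 * b / n) * x ^ 1 + (-(b / n ^ 2)) * x ^ 2 := by
    ext x
    field_simp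
    ring
  have i := fun k c => (integrable_pow_gammaMeasure n k).const_mul c
  rw [e]
  refine ⟨((i 0 _).add (i 1 _)).add (i 2 _), ?_⟩
  have f1 : ((n + 1).factorial : ℝ) = (n + 1) * n.factorial := by
    rw [Nat.factorial_succ]
    push_cast
    ring
  have f2 : ((n + 2).factorial : ℝ) = (n + 2) * ((n + 1) * n.factorial) := by
    rw [Nat.factorial_succ]
    push_cast
    rw [f1]
    ring
  have hf : (n.factorial : ℝ) ≠ 0 := by positivity
  rw [integral_add (by exact (i 0 _).add (i 1 _)) (i 2 _), integral_add (i 0 _) (i 1 _)]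
  simp only [integral_const_mul, integral_pow_gammaMeasure, f1, f2, add_zero]
  field_simp
  ring

theorem integrable_sqrt_normDispersion {α : Type*} [MeasurableSpace α] {μ : Measure α}
    [IsFiniteMeasure μ] {f : α → ℝ} (hf : AEMeasurable f μ) :
    Integrable (fun x => √(normDispersion (f x))) μ := by
  refine Integrable.of_bound
    ((measurable_normDispersion.comp_aemeasurable hf).sqrt).aestronglyMeasurable 1 ?_
  refine Filter.Eventually.of_forall fun x => ?_
  rw [Real.norm_of_nonneg (Real.sqrt_nonneg _)]
  exact Real.sqrt_le_one.2 (normDispersion_le_one _)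

/-- The quadratic bounds are integrated at `r = x / n`. The linear term contributes `a / n ≤ 1 / n`,
the quadratic one at most `2 (n + 2) / n² ≤ 6 / n`. -/
theorem abs_integral_sqrt_normDispersion_sub_le {n : ℕ} (hn : n ≠ 0) {γ : ℝ} (hγ : 0 < γ) :
    |∫ x, √(normDispersion (γ * x)) ∂gammaMeasure ((n + 1 : ℕ) : ℝ) 1 - √(normDispersion (γ * n))|
      ≤ 6 / n * √(normDispersion (γ * n)) := by
  have hn1 : (1 : ℝ) ≤ n := by exact_mod_cast Nat.one_le_iff_ne_zero.2 hn
  have := isProbabilityMeasure_gammaMeasure_nat_succ n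
  obtain ⟨a, ha0, ha1, h⟩ := sqrt_normDispersion_mul_bounds (y := γ * n) (by positivity)
  set M := √(normDispersion (γ * n)) with hM
  have hM0 : 0 ≤ M := Real.sqrt_nonneg _
  have hint : Integrable (fun x => √(normDispersion (γ * x)))
      (gammaMeasure ((n + 1 : ℕ) : ℝ) 1) := integrable_sqrt_normDispersion (by fun_prop)
  have hb : ∀ᵐ x ∂gammaMeasure ((n + 1 : ℕ) : ℝ) 1,
      (1 + a * (x / n - 1) - 2 * (x / n - 1) ^ 2) * M ≤ √(normDispersion (γ * x)) ∧
        √(normDispersion (γ * x)) ≤ (1 + a * (x / n - 1) - 0 * (x / n - 1) ^ 2) * M := by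
    filter_upwards [ae_gammaMeasure_pos n] with x hx
    have := h (x / n) (by positivity)
    rw [show γ * n * (x / n) = γ * x by field_simp] at this
    simpa using this
  obtain ⟨i2, e2⟩ := integral_quadratic_gammaMeasure hn a 2
  obtain ⟨i0, e0⟩ := integral_quadratic_gammaMeasure hn a 0
  have lo := integral_mono_ae (i2.mul_const M) hint (hb.mono fun x hx => hx.1)
  have up := integral_mono_ae hint (i0.mul_const M) (hb.mono fun x hx => hx.2)
  rw [integral_mul_const, e2] at lo
  rw [integral_mul_const, e0] at up
  have k1 : 2 * ((n : ℝ) + 2) / n ^ 2 ≤ 6 / n := by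
    rw [div_le_div_iff₀ (by positivity) (by positivity)]
    nlinarith
  have k2 : 0 ≤ a / n := by positivity
  have k3 : a / n ≤ 6 / n := by gcongr; linarith
  rw [abs_le]
  constructor
  · nlinarith
  · simp only [zero_mul, zero_div, sub_zero] at up
    nlinarith

/-! ### The Laplace approximation of the dispersion term -/

theorem rateLoss_eq (T : ℕ) (ε y : ℝ) :
    rateLoss T ε y = √(1 / T) * (Qinv ε / Real.log 2) * √(normDispersion y) := by
  have h : 0 < Real.log 2 := Real.log_pos one_lt_two
  rw [rateLoss, dispersion, ← mul_assoc, Real.sqrt_mul (by positivity),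
    Real.sqrt_mul (by positivity), Real.sqrt_sq_eq_abs, Real.logb, Real.log_exp,
    abs_of_pos (by positivity), normDispersion]
  ring

/-- Isolates the Stirling ratio, the only factor besides the value at the mode in which `Psi`
differs from the exact term. -/
theorem Psi_nat_succ {n : ℕ} (hn : n ≠ 0) (γ : ℝ) (T : ℕ) (ε : ℝ) :
    Psi γ (n + 1) T ε = √(1 / T) * (Qinv ε / Real.log 2) *
      (√(2 * π * n) * (n / Real.exp 1) ^ n / n.factorial * √(normDispersion (γ * n))) := by
  have hn' : (0 : ℝ) < n := by positivity
  have e1 : (((n + 1 : ℕ) : ℝ)) - 1 = n := by push_cast; ring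
  have e2 : (((n + 1 : ℕ) : ℝ)) - 1 / 2 = n + 1 / 2 := by push_cast; ring
  have e3 : √(2 * π / T) = √(2 * π) * √(1 / T) := by
    rw [← Real.sqrt_mul (by positivity)]
    congr 1
    ring
  have e4 : Real.exp 1 ^ n = Real.exp n := by rw [← Real.exp_nat_mul, mul_one]
  rw [Psi, e1, e2, e3, Nat.cast_add_one, Real.Gamma_nat_eq_factorial, Real.rpow_add hn',
    Real.rpow_natCast, ← Real.sqrt_eq_rpow, Real.sqrt_mul (by positivity) (n : ℝ), div_pow, e4,
    Real.exp_neg, normDispersion]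
  have hl : Real.log 2 ≠ 0 := (Real.log_pos one_lt_two).ne'
  field_simp

theorem abs_integral_rateLoss_sub_Psi_le {n : ℕ} (hn : n ≠ 0) {γ : ℝ} (hγ : 0 < γ) (T : ℕ)
    (ε : ℝ) :
    |∫ x, rateLoss T ε (γ * x) ∂gammaMeasure ((n + 1 : ℕ) : ℝ) 1 - Psi γ (n + 1) T ε| ≤
      7 / n * |Psi γ (n + 1) T ε| := by
  have hn1 : (1 : ℝ) ≤ n := by exact_mod_cast Nat.one_le_iff_ne_zero.2 hn
  obtain ⟨s1, s2⟩ := stirling_ratio_bounds hn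
  have h6 := abs_integral_sqrt_normDispersion_sub_le hn hγ
  rw [Psi_nat_succ hn]
  simp only [rateLoss_eq, integral_const_mul]
  set B := √(1 / (T : ℝ)) * (Qinv ε / Real.log 2)
  set S := √(2 * π * n) * (n / Real.exp 1) ^ n / n.factorial
  set M := √(normDispersion (γ * n))
  set I := ∫ x, √(normDispersion (γ * x)) ∂gammaMeasure ((n + 1 : ℕ) : ℝ) 1
  have hM : 0 ≤ M := Real.sqrt_nonneg _
  have k : 1 / (12 * (n : ℝ)) ≤ 1 / 12 := by
    apply one_div_le_one_div_of_le <;> linarith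
  have hS : 11 / 12 ≤ S := by linarith
  rw [← mul_sub, abs_mul, abs_mul B, abs_of_nonneg (by positivity : 0 ≤ S * M)]
  have h1 : |I - S * M| ≤ 6 / n * M + 1 / (12 * n) * M := by
    have : I - S * M = (I - M) + (1 - S) * M := by ring
    rw [this]
    refine (abs_add_le _ _).trans (add_le_add h6 ?_)
    rw [abs_of_nonneg (mul_nonneg (by linarith) hM)]
    exact mul_le_mul_of_nonneg_right (by linarith) hM
  -- The error is measured against `S * M` instead of `M`; with `S ≥ 11/12` this amounts to `6 +
  -- 1/12 = 73/12 ≤ 77/12 = 7 * 11/12`.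
  have h2 : 6 / n * M + 1 / (12 * n) * M ≤ 7 / n * (S * M) := by
    have e : 6 / n * M + 1 / (12 * n) * M = (73 / 12) * (M / n) := by
      field_simp
      ring
    have e' : 7 / n * (S * M) = (7 * S) * (M / n) := by ring
    rw [e, e']
    exact mul_le_mul_of_nonneg_right (by linarith) (by positivity)
  calc |B| * |I - S * M| ≤ |B| * (7 / n * (S * M)) :=
        mul_le_mul_of_nonneg_left (h1.trans h2) (abs_nonneg _)
    _ = _ := by ring

/-! ### The squared norm of a standard complex Gaussian vector -/

instance isProbabilityMeasure_complexGaussian (v : ℝ≥0) :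
    IsProbabilityMeasure (complexGaussian v) :=
  Measure.isProbabilityMeasure_map (by fun_prop)

instance isProbabilityMeasure_complexGaussianVec (N : ℕ) :
    IsProbabilityMeasure (complexGaussianVec N) :=
  Measure.isProbabilityMeasure_map (by fun_prop)

theorem integral_complexGaussian {E : Type*} [NormedAddCommGroup E] [NormedSpace ℝ E] (v : ℝ≥0)
    {f : ℂ → E} (hf : Continuous f) :
    ∫ z, f z ∂complexGaussian v =
      ∫ p : ℝ × ℝ, f ((p.1 : ℂ) + (p.2 : ℂ) * Complex.I)
        ∂((gaussianReal 0 (v / 2)).prod (gaussianReal 0 (v / 2))) := by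
  rw [complexGaussian, integral_map (by fun_prop)
    hf.aestronglyMeasurable]

/-- Induction on `n` by integration by parts. The condition `r.re = 1` covers `r = 1 - t i`, as
needed for the characteristic function of the Gamma law. -/
theorem integral_pow_mul_cexp_neg {r : ℂ} (hr : r.re = 1) (n : ℕ) :
    ∫ x in Set.Ioi (0 : ℝ), (x : ℂ) ^ n * Complex.exp (-(r * x)) = n.factorial / r ^ (n + 1) := by
  have hr0 : r ≠ 0 := by
    rintro rfl
    simp at hr
  have hnorm : ∀ (k : ℕ) (x : ℝ), 0 ≤ x →
      ‖(x : ℂ) ^ k * Complex.exp (-(r * x))‖ = x ^ k * Real.exp (-x) := by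
    intro k x hx
    rw [norm_mul, norm_pow, Complex.norm_real, Complex.norm_exp, Real.norm_of_nonneg hx]
    simp [hr]
  have hint : ∀ k : ℕ, IntegrableOn (fun x : ℝ => (x : ℂ) ^ k * Complex.exp (-(r * x)))
      (Set.Ioi 0) := by
    intro k
    refine (integrableOn_pow_mul_exp_neg k).mono' (by fun_prop) ?_
    filter_upwards [ae_restrict_mem measurableSet_Ioi] with x hx
    exact (hnorm k x (le_of_lt hx)).le
  have hlim : ∀ k : ℕ, Filter.Tendsto (fun x : ℝ => (x : ℂ) ^ k * Complex.exp (-(r * x)))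
      Filter.atTop (nhds 0) := by
    intro k
    rw [tendsto_zero_iff_norm_tendsto_zero]
    refine (Real.tendsto_pow_mul_exp_neg_atTop_nhds_zero k).congr' ?_
    filter_upwards [Filter.eventually_ge_atTop 0] with x hx
    exact (hnorm k x hx).symm
  have hexp : ∀ x : ℝ, HasDerivAt (fun x : ℝ => Complex.exp (-(r * x)))
      (Complex.exp (-(r * x)) * (-(r * 1))) x := fun x =>
    (((hasDerivAt_id x).ofReal_comp.const_mul r).neg).cexp
  induction n with
  | zero =>
    have h := integral_Ioi_of_hasDerivAt_of_tendsto' (a := 0) (m := 0)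
      (f := fun x : ℝ => (-r⁻¹) * ((x : ℂ) ^ 0 * Complex.exp (-(r * x))))
      (f' := fun x : ℝ => (x : ℂ) ^ 0 * Complex.exp (-(r * x)))
      (fun x _ => by
        convert! ((hexp x).const_mul (-r⁻¹)) using 1
        · ext; simp
        · field_simp) (hint 0) (by simpa using (hlim 0).const_mul (-r⁻¹))
    rw [h]
    simp
  | succ k ih =>
    have hpow : ∀ x : ℝ, HasDerivAt (fun x : ℝ => (x : ℂ) ^ (k + 1)) ((k + 1) * (x : ℂ) ^ k) x := by
      intro x
      have := ((hasDerivAt_id x).ofReal_comp).fun_pow (k + 1)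
      simpa using this
    have hi := ((hint k).const_mul ((k : ℂ) + 1)).sub ((hint (k + 1)).const_mul r)
    have h := integral_Ioi_of_hasDerivAt_of_tendsto' (a := 0) (m := 0)
      (f := fun x : ℝ => (x : ℂ) ^ (k + 1) * Complex.exp (-(r * x)))
      (f' := fun x : ℝ => ((k : ℂ) + 1) * ((x : ℂ) ^ k * Complex.exp (-(r * x))) -
        r * ((x : ℂ) ^ (k + 1) * Complex.exp (-(r * x))))
      (fun x _ => by
        convert! ((hpow x).mul (hexp x)) using 1
        ring) hi (hlim (k + 1))
    rw [integral_sub ((hint k).const_mul _) ((hint (k + 1)).const_mul r), integral_const_mul,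
      integral_const_mul, ih] at h
    simp only [Complex.ofReal_zero, ne_eq, Nat.add_eq_zero_iff, one_ne_zero, and_false,
      not_false_eq_true, zero_pow, zero_mul, sub_zero] at h
    rw [eq_div_iff (pow_ne_zero _ hr0), Nat.factorial_succ]
    rw [sub_eq_zero, mul_div_assoc', div_eq_iff (pow_ne_zero _ hr0)] at h
    push_cast
    rw [h]
    ring

theorem charFun_gammaMeasure_nat_succ (n : ℕ) (t : ℝ) :
    charFun (gammaMeasure ((n + 1 : ℕ) : ℝ) 1) t = (1 / (1 - t * Complex.I)) ^ (n + 1) := by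
  have hr : (1 - t * Complex.I : ℂ).re = 1 := by simp
  have h := integral_pow_mul_cexp_neg hr n
  have hf : (n.factorial : ℂ) ≠ 0 := Nat.cast_ne_zero.2 n.factorial_ne_zero
  rw [charFun_apply_real, integral_gammaMeasure_nat_succ, one_div_pow]
  have : (1 : ℂ) / (1 - t * Complex.I) ^ (n + 1) =
      (n.factorial : ℂ)⁻¹ * (n.factorial / (1 - t * Complex.I) ^ (n + 1)) := by
    rw [mul_div_assoc', inv_mul_cancel₀ hf]
  rw [this, ← h, ← integral_const_mul]
  refine setIntegral_congr_fun measurableSet_Ioi fun x _ => ?_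
  rw [Complex.real_smul]
  push_cast
  rw [show -((1 - t * Complex.I) * x) = -(x : ℂ) + t * x * Complex.I by ring, Complex.exp_add]
  field_simp

/-- Squaring removes the branch of the complex square root in the Gaussian integral. The square is
also what arises from the independent real and imaginary parts of a `CN(0, 1)` variable. -/
theorem integral_cexp_sq_gaussianReal (t : ℝ) :
    (∫ x : ℝ, Complex.exp (t * (x : ℂ) ^ 2 * Complex.I) ∂gaussianReal 0 (1 / 2)) ^ 2 =
      1 / (1 - t * Complex.I) := by
  have hb : 0 < (1 - t * Complex.I : ℂ).re := by simp
  have hb0 : (1 - t * Complex.I : ℂ) ≠ 0 := by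
    intro h
    simp [h] at hb
  have h := integral_gaussian_complex hb
  have hpdf : ∀ x : ℝ, gaussianPDFReal 0 (1 / 2) x • Complex.exp (t * (x : ℂ) ^ 2 * Complex.I) =
      ((√π)⁻¹ : ℝ) * Complex.exp (-(1 - t * Complex.I) * (x : ℂ) ^ 2) := by
    intro x
    rw [gaussianPDFReal, Complex.real_smul]
    have e1 : 2 * π * ((1 / 2 : ℝ≥0) : ℝ) = π := by
      push_cast
      ring
    have e2 : -(x - 0) ^ 2 / (2 * ((1 / 2 : ℝ≥0) : ℝ)) = -x ^ 2 := by
      push_cast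
      ring
    rw [e1, e2]
    push_cast
    rw [mul_assoc, ← Complex.exp_add]
    congr 2
    ring
  rw [integral_gaussianReal_eq_integral_smul (by norm_num)]
  simp_rw [hpdf]
  rw [integral_const_mul, h, mul_pow, ← Complex.cpow_nat_mul]
  norm_cast
  rw [inv_pow, Real.sq_sqrt pi_pos.le]
  push_cast
  have : (π : ℂ) ≠ 0 := by exact_mod_cast pi_ne_zero
  norm_num
  field_simp

theorem integral_cexp_normSq_complexGaussian (t : ℝ) :
    ∫ z, Complex.exp (t * (‖z‖ : ℂ) ^ 2 * Complex.I) ∂complexGaussian 1 =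
      1 / (1 - t * Complex.I) := by
  rw [integral_complexGaussian _ (by fun_prop), ← integral_cexp_sq_gaussianReal, pow_two,
    ← integral_prod_mul]
  refine integral_congr_ae (Filter.Eventually.of_forall fun p => ?_)
  simp only
  have : (‖(p.1 : ℂ) + p.2 * Complex.I‖ : ℂ) ^ 2 = (p.1 : ℂ) ^ 2 + (p.2 : ℂ) ^ 2 := by
    norm_cast
    rw [Complex.sq_norm, Complex.normSq_add_mul_I]
  rw [← Complex.exp_add, this]
  congr 1
  ring

theorem hasLaw_normSq_complexGaussianVec (n : ℕ) :
    HasLaw (fun v : EuclideanSpace ℂ (Fin (n + 1)) => ‖v‖ ^ 2)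
      (gammaMeasure ((n + 1 : ℕ) : ℝ) 1) (complexGaussianVec (n + 1)) where
  aemeasurable := by fun_prop
  map_eq := by
    have := isProbabilityMeasure_gammaMeasure_nat_succ n
    have : IsProbabilityMeasure ((complexGaussianVec (n + 1)).map fun v => ‖v‖ ^ 2) :=
      Measure.isProbabilityMeasure_map (by fun_prop)
    refine Measure.ext_of_charFun (funext fun t => ?_)
    rw [charFun_gammaMeasure_nat_succ, charFun_apply_real,
      integral_map (by fun_prop) (by fun_prop), complexGaussianVec,
      integral_map (by fun_prop) (by fun_prop), ← integral_cexp_normSq_complexGaussian]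
    have h := integral_fintype_prod_eq_pow (ι := Fin (n + 1)) (μ := complexGaussian 1)
      (fun z : ℂ => Complex.exp (t * (‖z‖ : ℂ) ^ 2 * Complex.I))
    rw [Fintype.card_fin] at h
    rw [← h]
    refine integral_congr_ae (Filter.Eventually.of_forall fun v => ?_)
    simp only
    rw [← Complex.exp_sum, EuclideanSpace.norm_sq_eq]
    push_cast
    rw [Finset.mul_sum, Finset.sum_mul]

/-! ### Moments of complex Gaussian laws -/

theorem integrable_normSq {α : Type*} [MeasurableSpace α] {μ : Measure α} {f : α → ℂ}
    (hf : MemLp f 2 μ) : Integrable (fun x => ‖f x‖ ^ 2) μ :=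
  (memLp_two_iff_integrable_sq_norm hf.aestronglyMeasurable).1 hf

theorem memLp_comp_of_hasLaw {α β : Type*} [MeasurableSpace α] [MeasurableSpace β] {μ : Measure α}
    {ν : Measure β} {X : α → β} {f : β → ℂ} (hX : HasLaw X ν μ) (hf : MemLp f 2 ν) :
    MemLp (fun a => f (X a)) 2 μ := by
  rw [← hX.map_eq] at hf
  exact hf.comp_of_map hX.aemeasurable

theorem integral_sq_gaussianReal (v : ℝ≥0) : ∫ x, x ^ 2 ∂gaussianReal 0 v = v := by
  have h := variance_id_gaussianReal (μ := 0) (v := v)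
  rw [variance_of_integral_eq_zero aemeasurable_id (by simp)] at h
  simpa using h

theorem memLp_id_complexGaussian (v : ℝ≥0) : MemLp id 2 (complexGaussian v) := by
  rw [complexGaussian, memLp_map_measure_iff (by fun_prop) (by fun_prop)]
  have h := memLp_id_gaussianReal' (μ := 0) (v := v / 2) 2 (by simp)
  have h1 : MemLp (fun p : ℝ × ℝ => p.1) 2 ((gaussianReal 0 (v / 2)).prod (gaussianReal 0 (v / 2))) :=
    h.comp_measurePreserving measurePreserving_fst
  have h2 : MemLp (fun p : ℝ × ℝ => p.2) 2 ((gaussianReal 0 (v / 2)).prod (gaussianReal 0 (v / 2))) :=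
    h.comp_measurePreserving measurePreserving_snd
  have h3 : MemLp (fun p : ℝ × ℝ => (p.1 : ℂ) + (p.2 : ℂ) * Complex.I) 2
      ((gaussianReal 0 (v / 2)).prod (gaussianReal 0 (v / 2))) :=
    MemLp.add (f := fun p : ℝ × ℝ => (p.1 : ℂ)) (g := fun p : ℝ × ℝ => (p.2 : ℂ) * Complex.I)
      h1.ofReal (h2.ofReal.mul_const Complex.I)
  exact h3

theorem integral_id_complexGaussian (v : ℝ≥0) : ∫ z, z ∂complexGaussian v = 0 := by
  have h : Integrable (fun x : ℝ => (x : ℂ)) (gaussianReal 0 (v / 2)) :=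
    ((memLp_id_gaussianReal' (μ := 0) (v := v / 2) 1 (by simp)).integrable le_rfl).ofReal
  have h0 : ∫ x : ℝ, (x : ℂ) ∂gaussianReal 0 (v / 2) = 0 := by
    rw [integral_complex_ofReal, integral_id_gaussianReal, Complex.ofReal_zero]
  rw [integral_complexGaussian v continuous_id']
  rw [integral_add (h.comp_fst _) ((h.comp_snd _).mul_const _), integral_mul_const,
    integral_fun_fst (fun x : ℝ => (x : ℂ)), integral_fun_snd (fun x : ℝ => (x : ℂ)), h0]
  simp

theorem integral_normSq_complexGaussian (v : ℝ≥0) : ∫ z, ‖z‖ ^ 2 ∂complexGaussian v = v := by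
  have h : Integrable (fun x : ℝ => x ^ 2) (gaussianReal 0 (v / 2)) :=
    (memLp_id_gaussianReal' (μ := 0) (v := v / 2) 2 (by simp)).integrable_sq
  rw [integral_complexGaussian v (by fun_prop)]
  simp only [Complex.sq_norm, Complex.normSq_add_mul_I]
  rw [integral_add (h.comp_fst _) (h.comp_snd _),
    integral_fun_fst (fun x : ℝ => x ^ 2), integral_fun_snd (fun x : ℝ => x ^ 2),
    integral_sq_gaussianReal]
  simp

theorem memLp_rowMul_pi {N : ℕ} (w : EuclideanSpace ℂ (Fin N)) :
    MemLp (fun x : Fin N → ℂ => ∑ j, x j * w j) 2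
      (Measure.pi fun _ : Fin N => complexGaussian 1) := by
  refine memLp_finsetSum _ fun j _ => MemLp.mul_const ?_ _
  exact (memLp_id_complexGaussian 1).comp_measurePreserving
    (measurePreserving_eval (fun _ : Fin N => complexGaussian 1) j)

theorem measurable_rowMul {N : ℕ} : Measurable fun p : EuclideanSpace ℂ (Fin N) ×
    EuclideanSpace ℂ (Fin N) => rowMul p.1 p.2 := by
  unfold rowMul
  fun_prop

theorem measurable_rowMul_left {N : ℕ} (w : EuclideanSpace ℂ (Fin N)) :
    Measurable fun x : EuclideanSpace ℂ (Fin N) => rowMul x w := by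
  unfold rowMul
  fun_prop

theorem memLp_rowMul {N : ℕ} (w : EuclideanSpace ℂ (Fin N)) :
    MemLp (fun x => rowMul x w) 2 (complexGaussianVec N) := by
  rw [complexGaussianVec, memLp_map_measure_iff
    (measurable_rowMul_left w).aestronglyMeasurable (by fun_prop)]
  exact memLp_rowMul_pi w

theorem integral_eval_pi_complexGaussian {N : ℕ} {E : Type*} [NormedAddCommGroup E]
    [NormedSpace ℝ E] (j : Fin N) {f : ℂ → E} (hf : Continuous f) :
    ∫ x, f (x j) ∂(Measure.pi fun _ : Fin N => complexGaussian 1) =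
      ∫ z, f z ∂complexGaussian 1 := by
  have h := measurePreserving_eval (fun _ : Fin N => complexGaussian 1) j
  exact h.hasLaw.integral_comp hf.aestronglyMeasurable

theorem integral_rowMul {N : ℕ} (w : EuclideanSpace ℂ (Fin N)) :
    ∫ x, rowMul x w ∂complexGaussianVec N = 0 := by
  rw [complexGaussianVec, integral_map (by fun_prop)
    (measurable_rowMul_left w).aestronglyMeasurable]
  simp only [rowMul]
  rw [integral_finsetSum]
  · refine Finset.sum_eq_zero fun j _ => ?_
    rw [integral_mul_const, integral_eval_pi_complexGaussian j continuous_id',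
      integral_id_complexGaussian, zero_mul]
  · intro j _
    refine Integrable.mul_const ?_ _
    exact ((memLp_id_complexGaussian 1).comp_measurePreserving (measurePreserving_eval
      (fun _ : Fin N => complexGaussian 1) j)).integrable one_le_two

/-- The coordinates are orthonormal in `L²`, so only the diagonal of the expanded double sum
survives. -/
theorem integral_normSq_rowMul {N : ℕ} (w : EuclideanSpace ℂ (Fin N)) :
    ∫ x, ‖rowMul x w‖ ^ 2 ∂complexGaussianVec N = ‖w‖ ^ 2 := by
  set ν : Measure (Fin N → ℂ) := Measure.pi fun _ : Fin N => complexGaussian 1 with hν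
  have hmem : ∀ j : Fin N, MemLp (fun x : Fin N → ℂ => x j) 2 ν := fun j =>
    (memLp_id_complexGaussian 1).comp_measurePreserving
      (measurePreserving_eval (fun _ : Fin N => complexGaussian 1) j)
  have hpair : ∀ j k : Fin N, ∫ x, x j * (starRingEnd ℂ) (x k) ∂ν = if j = k then 1 else 0 := by
    intro j k
    split_ifs with h
    · subst h
      simp_rw [Complex.mul_conj']
      rw [integral_eval_pi_complexGaussian j (f := fun z : ℂ => (‖z‖ : ℂ) ^ 2) (by fun_prop)]
      have := integral_normSq_complexGaussian 1
      norm_cast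
    · have hind : IndepFun (fun x : Fin N → ℂ => x j) (fun x : Fin N → ℂ => x k) ν :=
        (iIndepFun_pi (μ := fun _ : Fin N => complexGaussian 1) (X := fun _ => id)
          (fun _ => aemeasurable_id)).indepFun h
      have h2 := (hind.comp (φ := id) (ψ := starRingEnd ℂ) measurable_id
        Complex.continuous_conj.measurable).integral_fun_mul_eq_mul_integral
        (hmem j).aestronglyMeasurable (hmem k).star.aestronglyMeasurable
      simp only [Function.comp_apply, id_eq] at h2
      rw [h2]
      have h3 : ∫ x, x j ∂ν = 0 := by
        rw [hν, integral_eval_pi_complexGaussian j continuous_id', integral_id_complexGaussian]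
      simp [h3]
  have hint : ∀ j k : Fin N, Integrable (fun x : Fin N → ℂ =>
      x j * (starRingEnd ℂ) (x k)) ν := fun j k =>
    (hmem j).integrable_mul ((hmem k).star)
  rw [complexGaussianVec, integral_map (by fun_prop)
    ((measurable_rowMul_left w).norm.pow_const 2).aestronglyMeasurable]
  have hexp : ∀ x : Fin N → ℂ, ((‖rowMul (WithLp.toLp 2 x) w‖ ^ 2 : ℝ) : ℂ) =
      ∑ j, ∑ k, (w j * (starRingEnd ℂ) (w k)) * (x j * (starRingEnd ℂ) (x k)) := by
    intro x
    push_cast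
    rw [← Complex.mul_conj', rowMul, map_sum, Finset.sum_mul_sum]
    refine Finset.sum_congr rfl fun j _ => Finset.sum_congr rfl fun k _ => ?_
    rw [map_mul]
    ring
  have : ((∫ x, ‖rowMul (WithLp.toLp 2 x) w‖ ^ 2 ∂ν : ℝ) : ℂ) = ((‖w‖ ^ 2 : ℝ) : ℂ) := by
    rw [← integral_complex_ofReal]
    simp_rw [hexp]
    rw [integral_finsetSum _ fun j _ => integrable_finsetSum _ fun k _ => (hint j k).const_mul _]
    simp_rw [integral_finsetSum _ fun k _ => (hint _ k).const_mul _, integral_const_mul, hpair]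
    simp only [mul_ite, mul_one, mul_zero, Finset.sum_ite_eq, Finset.mem_univ, if_true]
    rw [EuclideanSpace.norm_sq_eq]
    push_cast
    exact Finset.sum_congr rfl fun j _ => Complex.mul_conj' _
  exact_mod_cast this

/-! ### The beamforming vector -/

theorem norm_beamformer {N : ℕ} {h : EuclideanSpace ℂ (Fin N)} (hh : h ≠ 0) :
    ‖beamformer h‖ = 1 := by
  have : ‖(WithLp.toLp 2 (fun j => (starRingEnd ℂ) (h j)) : EuclideanSpace ℂ (Fin N))‖ = ‖h‖ := by
    simp [EuclideanSpace.norm_eq]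
  rw [beamformer, norm_smul, this, Complex.norm_real, norm_inv, norm_norm,
    inv_mul_cancel₀ (norm_ne_zero_iff.2 hh)]

theorem norm_beamformer_le {N : ℕ} (h : EuclideanSpace ℂ (Fin N)) : ‖beamformer h‖ ≤ 1 := by
  rcases eq_or_ne h 0 with rfl | hh
  · simp [beamformer]
  · exact (norm_beamformer hh).le

theorem measurable_beamformer {N : ℕ} :
    Measurable (beamformer : EuclideanSpace ℂ (Fin N) → EuclideanSpace ℂ (Fin N)) := by
  unfold beamformer
  fun_prop

theorem ae_complexGaussianVec_ne_zero {N : ℕ} (hN : N ≠ 0) :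
    ∀ᵐ h ∂complexGaussianVec N, h ≠ 0 := by
  obtain ⟨n, rfl⟩ := Nat.exists_eq_succ_of_ne_zero hN
  have h := ((hasLaw_normSq_complexGaussianVec n).ae_iff (p := fun x => 0 < x)
    (measurableSet_setOfPred.1 measurableSet_Ioi)).2 (ae_gammaMeasure_pos n)
  filter_upwards [h] with v hv h0
  simp [h0] at hv

theorem measurable_rowMul_beamformer {N : ℕ} :
    Measurable fun p : EuclideanSpace ℂ (Fin N) × EuclideanSpace ℂ (Fin N) =>
      rowMul p.2 (beamformer p.1) :=
  measurable_rowMul.comp (measurable_snd.prodMk (measurable_beamformer.comp measurable_fst))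

theorem integrable_normSq_rowMul_beamformer (N : ℕ) :
    Integrable (fun p : EuclideanSpace ℂ (Fin N) × EuclideanSpace ℂ (Fin N) =>
      ‖rowMul p.2 (beamformer p.1)‖ ^ 2) ((complexGaussianVec N).prod (complexGaussianVec N)) := by
  rw [integrable_prod_iff (measurable_rowMul_beamformer.norm.pow_const 2).aestronglyMeasurable]
  refine ⟨Filter.Eventually.of_forall fun h =>
    integrable_normSq (f := fun x => rowMul x (beamformer h)) (memLp_rowMul _), ?_⟩
  simp only [norm_pow, norm_norm, integral_normSq_rowMul]
  refine Integrable.of_bound (measurable_beamformer.norm.pow_const 2).aestronglyMeasurable 1 ?_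
  refine Filter.Eventually.of_forall fun h => ?_
  rw [norm_pow, norm_norm]
  exact pow_le_one₀ (norm_nonneg _) (norm_beamformer_le h)

theorem memLp_rowMul_beamformer (N : ℕ) :
    MemLp (fun p : EuclideanSpace ℂ (Fin N) × EuclideanSpace ℂ (Fin N) =>
      rowMul p.2 (beamformer p.1)) 2 ((complexGaussianVec N).prod (complexGaussianVec N)) :=
  (memLp_two_iff_integrable_sq_norm measurable_rowMul_beamformer.aestronglyMeasurable).2
    (integrable_normSq_rowMul_beamformer N)

theorem integral_rowMul_beamformer (N : ℕ) :
    ∫ p : EuclideanSpace ℂ (Fin N) × EuclideanSpace ℂ (Fin N),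
      rowMul p.2 (beamformer p.1) ∂((complexGaussianVec N).prod (complexGaussianVec N)) = 0 := by
  rw [integral_prod _ ((memLp_rowMul_beamformer N).integrable one_le_two)]
  simp [integral_rowMul]

/-- By Fubini, the inner integral at fixed `h` is `‖beamformer h‖²`, which is 1 except on the null
event `h = 0`. -/
theorem integral_normSq_rowMul_beamformer {N : ℕ} (hN : N ≠ 0) :
    ∫ p : EuclideanSpace ℂ (Fin N) × EuclideanSpace ℂ (Fin N),
      ‖rowMul p.2 (beamformer p.1)‖ ^ 2
        ∂((complexGaussianVec N).prod (complexGaussianVec N)) = 1 := by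
  have hi := integrable_normSq_rowMul_beamformer N
  rw [integral_prod _ hi]
  simp only [integral_normSq_rowMul]
  rw [integral_congr_ae (g := fun _ => (1 : ℝ))]
  · simp
  · filter_upwards [ae_complexGaussianVec_ne_zero hN] with h hh
    simp [norm_beamformer hh]

/-! ### The variance of the interference plus noise -/

theorem complexVar_add_of_indepFun {Ω : Type*} [MeasurableSpace Ω] {μ : Measure Ω}
    [IsProbabilityMeasure μ] {X Y : Ω → ℂ} (hX : MemLp X 2 μ) (hY : MemLp Y 2 μ)
    (hXY : IndepFun X Y μ) (hX0 : ∫ ω, X ω ∂μ = 0) (hY0 : ∫ ω, Y ω ∂μ = 0) :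
    complexVar μ (fun ω => X ω + Y ω) = ∫ ω, ‖X ω‖ ^ 2 ∂μ + ∫ ω, ‖Y ω‖ ^ 2 ∂μ := by
  have iX := integrable_normSq hX
  have iY := integrable_normSq hY
  have iXY : Integrable (fun ω => X ω * (starRingEnd ℂ) (Y ω)) μ := hX.integrable_mul hY.star
  have hcross : ∫ ω, X ω * (starRingEnd ℂ) (Y ω) ∂μ = 0 := by
    have h := (hXY.comp (φ := id) (ψ := starRingEnd ℂ) measurable_id
      Complex.continuous_conj.measurable).integral_fun_mul_eq_mul_integral
      hX.aestronglyMeasurable hY.star.aestronglyMeasurable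
    simp only [Function.comp_def, id_eq] at h
    rw [h, hX0, zero_mul]
  rw [complexVar, integral_add (hX.integrable one_le_two) (hY.integrable one_le_two), hX0, hY0]
  simp only [add_zero, sub_zero]
  have e : ∀ ω, ‖X ω + Y ω‖ ^ 2 = ‖X ω‖ ^ 2 + ‖Y ω‖ ^ 2 +
      2 * (X ω * (starRingEnd ℂ) (Y ω)).re := by
    intro ω
    simp only [Complex.sq_norm]
    exact Complex.normSq_add _ _
  simp_rw [e]
  have hre : ∫ ω, (X ω * (starRingEnd ℂ) (Y ω)).re ∂μ = 0 := by
    have h : ∫ ω, (X ω * (starRingEnd ℂ) (Y ω)).re ∂μ =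
      (∫ ω, X ω * (starRingEnd ℂ) (Y ω) ∂μ).re := integral_re iXY
    rw [h, hcross, Complex.zero_re]
  have iRe : Integrable (fun ω => 2 * (X ω * (starRingEnd ℂ) (Y ω)).re) μ := iXY.re.const_mul 2
  have iS : Integrable (fun ω => ‖X ω‖ ^ 2 + ‖Y ω‖ ^ 2) μ := iX.add iY
  rw [integral_add iS iRe, integral_add iX iY, integral_const_mul, hre, mul_zero, add_zero]

namespace IsUplinkModel

variable {Ω : Type*} [MeasurableSpace Ω] {N : ℕ} {μ : Measure Ω}
  {σ2 : ℝ≥0} {hu e : Ω → EuclideanSpace ℂ (Fin N)} {u z : Ω → ℂ}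

theorem ae_norm_beamformer (h : IsUplinkModel μ σ2 hu e u z) (hN : N ≠ 0) :
    ∀ᵐ ω ∂μ, ‖beamformer (hu ω)‖ = 1 := by
  have h0 := (h.hu_law.ae_iff (p := fun v => v ≠ 0)
    (measurableSet_setOfPred.1 (measurableSet_singleton 0).compl)).2
      (ae_complexGaussianVec_ne_zero hN)
  filter_upwards [h0] with ω hω using norm_beamformer hω

theorem integral_normSq_signal (h : IsUplinkModel μ σ2 hu e u z) (hN : N ≠ 0) : ∫ ω, ‖u ω‖ ^ 2 ∂μ = 1 := by
  rw [← h.power]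
  refine integral_congr_ae ?_
  filter_upwards [h.ae_norm_beamformer hN] with ω hω
  rw [norm_smul, hω, mul_one]

theorem memLp_signal (h : IsUplinkModel μ σ2 hu e u z) (hN : N ≠ 0) : MemLp u 2 μ := by
  refine (memLp_two_iff_integrable_sq_norm h.u_meas.aestronglyMeasurable).2 ?_
  -- A non-integrable function has Bochner integral 0, so the power constraint itself forces square
  -- integrability.
  by_contra hn
  have := h.integral_normSq_signal hN
  rw [integral_undef hn] at this
  exact zero_ne_one this

theorem hasLaw_prod [IsProbabilityMeasure μ] (h : IsUplinkModel μ σ2 hu e u z) : HasLaw (fun ω => (hu ω, e ω))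
    ((complexGaussianVec N).prod (complexGaussianVec N)) μ :=
  h.indep_hu_e.hasLaw_prod h.hu_law h.e_law

theorem effNoiseVar_eq [IsProbabilityMeasure μ] (h : IsUplinkModel μ σ2 hu e u z) (hN : N ≠ 0)
    {P φ : ℝ} (hP : 0 ≤ P) (hφ : φ ≤ 1) :
    effNoiseVar μ P φ hu e u z = P * (1 - φ) + σ2 := by
  set c : ℂ := ((√(P * (1 - φ)) : ℝ) : ℂ) with hc
  set W : Ω → ℂ := fun ω => rowMul (e ω) (beamformer (hu ω)) with hW
  have hcn : ‖c‖ ^ 2 = P * (1 - φ) := by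
    rw [hc, Complex.norm_real, Real.norm_of_nonneg (Real.sqrt_nonneg _),
      Real.sq_sqrt (mul_nonneg hP (by linarith))]
  have hlaw := h.hasLaw_prod
  have hWmem : MemLp W 2 μ := by
    have hm := memLp_comp_of_hasLaw hlaw (memLp_rowMul_beamformer N)
    exact hm
  have hWu : IndepFun W u μ := by
    have hm := h.indep_u.comp (measurable_rowMul_beamformer (N := N)) measurable_id
    exact hm
  have hW0 : ∫ ω, W ω ∂μ = 0 := by
    rw [← integral_rowMul_beamformer N]
    have hm := hlaw.integral_comp
      (measurable_rowMul_beamformer (N := N)).stronglyMeasurable.aestronglyMeasurable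
    exact hm
  have hW2 : ∫ ω, ‖W ω‖ ^ 2 ∂μ = 1 := by
    rw [← integral_normSq_rowMul_beamformer hN]
    have hm := hlaw.integral_comp
      ((measurable_rowMul_beamformer (N := N)).norm.pow_const 2).stronglyMeasurable.aestronglyMeasurable
    exact hm
  have hsq : IndepFun (fun ω => ‖W ω‖ ^ 2) (fun ω => ‖u ω‖ ^ 2) μ :=
    hWu.comp (φ := fun w : ℂ => ‖w‖ ^ 2) (ψ := fun w : ℂ => ‖w‖ ^ 2) (by fun_prop) (by fun_prop)
  have hWu2 : ∫ ω, ‖W ω * u ω‖ ^ 2 ∂μ = 1 := by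
    simp only [norm_mul, mul_pow]
    rw [hsq.integral_fun_mul_eq_mul_integral
      (integrable_normSq hWmem).aestronglyMeasurable
      (integrable_normSq (h.memLp_signal hN)).aestronglyMeasurable, hW2,
      h.integral_normSq_signal hN, mul_one]
  have hWum : MemLp (fun ω => W ω * u ω) 2 μ := by
    have hm : AEStronglyMeasurable (fun ω => W ω * u ω) μ :=
      hWmem.aestronglyMeasurable.mul (h.memLp_signal hN).aestronglyMeasurable
    refine (memLp_two_iff_integrable_sq_norm hm).2 ?_
    by_contra hn
    rw [integral_undef hn] at hWu2
    exact zero_ne_one hWu2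
  have hzmem : MemLp z 2 μ := by
    have hm := memLp_comp_of_hasLaw h.n_law (memLp_id_complexGaussian σ2)
    exact hm
  have hz0 : ∫ ω, z ω ∂μ = 0 := by
    rw [← integral_id_complexGaussian σ2]
    exact h.n_law.integral_comp (f := fun w => w) (by fun_prop)
  have hz2 : ∫ ω, ‖z ω‖ ^ 2 ∂μ = σ2 := by
    rw [← integral_normSq_complexGaussian σ2]
    exact h.n_law.integral_comp (f := fun w => ‖w‖ ^ 2) (by fun_prop)
  have hind : IndepFun (fun ω => c * (W ω * u ω)) z μ := by
    have hmeas : Measurable fun p : EuclideanSpace ℂ (Fin N) × EuclideanSpace ℂ (Fin N) × ℂ =>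
        c * (rowMul p.2.1 (beamformer p.1) * p.2.2) :=
      ((measurable_rowMul_beamformer.comp
        (measurable_fst.prodMk measurable_snd.fst)).mul measurable_snd.snd).const_mul c
    have hm := h.indep_n.comp hmeas measurable_id
    exact hm
  -- The signal `u` need not be centred: the mean vanishes because that of `W` does.
  have hm0 : ∫ ω, c * (W ω * u ω) ∂μ = 0 := by
    rw [integral_const_mul, hWu.integral_fun_mul_eq_mul_integral hWmem.aestronglyMeasurable
      (h.memLp_signal hN).aestronglyMeasurable, hW0, zero_mul, mul_zero]
  have hm2 : ∫ ω, ‖c * (W ω * u ω)‖ ^ 2 ∂μ = P * (1 - φ) := by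
    simp only [norm_mul c, mul_pow ‖c‖]
    rw [integral_const_mul, hWu2, hcn, mul_one]
  have heq : (fun ω => effNoise P φ (hu ω) (e ω) (u ω) (z ω)) =
      fun ω => c * (W ω * u ω) + z ω := by
    funext ω
    rw [effNoise, mul_assoc]
  rw [effNoiseVar, heq, complexVar_add_of_indepFun (hWum.const_mul c) hzmem hind hm0 hz0, hm2, hz2]

theorem hasLaw_normSq (h : IsUplinkModel μ σ2 hu e u z) (hN : N ≠ 0) :
    HasLaw (fun ω => ‖hu ω‖ ^ 2) (gammaMeasure N 1) μ := by
  obtain ⟨n, rfl⟩ := Nat.exists_eq_succ_of_ne_zero hN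
  exact (hasLaw_normSq_complexGaussianVec n).fun_comp h.hu_law

theorem sinr_eq [IsProbabilityMeasure μ] (h : IsUplinkModel μ σ2 hu e u z) (hN : N ≠ 0)
    {P φ : ℝ} (hP : 0 < P) (hφ : φ ≤ 1)
    (hσ : 0 < σ2) (ω : Ω) : sinr μ P φ hu e u z ω = effSNR (P / σ2) φ * ‖hu ω‖ ^ 2 := by
  have hσ' : (0 : ℝ) < σ2 := hσ
  have h1 : 0 ≤ P * (1 - φ) := mul_nonneg hP.le (by linarith)
  rw [sinr, h.effNoiseVar_eq hN hP.le hφ, effSNR]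
  have h2 : P * (1 - φ) + σ2 ≠ 0 := by positivity
  have h3 : (1 - φ) * (P / σ2) + 1 = (P * (1 - φ) + σ2) / σ2 := by
    field_simp
  rw [h3]
  field_simp

end IsUplinkModel

/-! ### The Laplace transform of `t ^ i log t` on `(1, ∞)` and its Mellin transform -/

/-- `∫_1^∞ t ^ i log t e^{-x t} dt`. -/
noncomputable def logLaplace (i : ℕ) (x : ℝ) : ℝ :=
  ∫ t in Set.Ioi (1 : ℝ), t ^ i * Real.log t * Real.exp (-(x * t))

theorem integrableOn_rpow_mul_exp_neg_mul {a r : ℝ} (ha : 0 < a) (hr : 0 < r) :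
    IntegrableOn (fun t : ℝ => t ^ (a - 1) * Real.exp (-(r * t))) (Set.Ioi 0) := by
  by_contra h
  have h1 := Real.integral_rpow_mul_exp_neg_mul_Ioi ha hr
  rw [integral_undef h] at h1
  have : 0 < (1 / r) ^ a * Real.Gamma a :=
    mul_pos (Real.rpow_pos_of_pos (by positivity) _) (Real.Gamma_pos_of_pos ha)
  linarith

theorem integrableOn_pow_mul_log_mul_exp_neg_mul (i : ℕ) {x : ℝ} (hx : 0 < x) :
    IntegrableOn (fun t : ℝ => t ^ i * Real.log t * Real.exp (-(x * t))) (Set.Ioi 1) := by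
  have h := (integrableOn_rpow_mul_exp_neg_mul (a := (i : ℝ) + 2) (by positivity) hx).mono_set
    (Set.Ioi_subset_Ioi zero_le_one)
  refine h.mono' (by fun_prop) ?_
  filter_upwards [ae_restrict_mem measurableSet_Ioi] with t ht
  have ht : (1 : ℝ) < t := ht
  have hlog := Real.log_nonneg ht.le
  have e : t ^ ((i : ℝ) + 2 - 1) = t ^ i * t := by
    rw [show (i : ℝ) + 2 - 1 = ((i + 1 : ℕ) : ℝ) by push_cast; ring, Real.rpow_natCast, pow_succ]
  rw [Real.norm_of_nonneg (by positivity), e]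
  gcongr
  exact Real.log_le_self (by linarith)

theorem integrableOn_rpow_mul_log {a : ℝ} (ha : a < 0) :
    IntegrableOn (fun t : ℝ => t ^ (a - 1) * Real.log t) (Set.Ioi 1) := by
  have h := (integrableOn_Ioi_rpow_of_lt (a := a / 2 - 1) (by linarith) one_pos).const_mul
    (1 / (-a / 2))
  refine h.mono' (by fun_prop) ?_
  filter_upwards [ae_restrict_mem measurableSet_Ioi] with t ht
  have ht : (1 : ℝ) < t := ht
  have ht0 : 0 < t := by linarith
  have hlog := Real.log_nonneg ht.le
  -- Half of the decay `t ^ a` absorbs the logarithm; the other half leaves the integrable power `t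
  -- ^ (a / 2 - 1)`.
  have h1 := Real.log_le_rpow_div ht0.le (show 0 < -a / 2 by linarith)
  rw [Real.norm_of_nonneg (by positivity)]
  calc t ^ (a - 1) * Real.log t ≤ t ^ (a - 1) * (t ^ (-a / 2) / (-a / 2)) := by gcongr
    _ = 1 / (-a / 2) * (t ^ (a - 1) * t ^ (-a / 2)) := by ring
    _ = _ := by
      rw [← Real.rpow_add ht0]
      ring_nf

theorem tendsto_rpow_mul_log_atTop {a : ℝ} (ha : a < 0) :
    Filter.Tendsto (fun t : ℝ => t ^ a * Real.log t) Filter.atTop (nhds 0) := by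
  have h := (isLittleO_log_rpow_atTop (r := -a) (by linarith)).tendsto_div_nhds_zero
  refine h.congr' ?_
  filter_upwards [Filter.eventually_gt_atTop 0] with t ht
  rw [Real.rpow_neg ht.le, div_inv_eq_mul, mul_comm]

theorem integral_cpow_mul_log {s : ℂ} (hs : s.re < 0) :
    ∫ t in Set.Ioi (1 : ℝ), (t : ℂ) ^ (s - 1) * (Real.log t : ℂ) = 1 / s ^ 2 := by
  have hs0 : s ≠ 0 := by
    rintro rfl
    simp at hs
  have hderiv : ∀ t ∈ Set.Ici (1 : ℝ), HasDerivAt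
      (fun t : ℝ => (t : ℂ) ^ s * ((Real.log t : ℂ) / s - 1 / s ^ 2))
      ((t : ℂ) ^ (s - 1) * (Real.log t : ℂ)) t := by
    intro t ht
    have ht0 : t ≠ 0 := by
      have : (1 : ℝ) ≤ t := ht
      linarith
    have ht0' : (t : ℂ) ≠ 0 := by exact_mod_cast ht0
    have h1 := hasDerivAt_ofReal_cpow_const ht0 hs0
    have h2 := (((Real.hasDerivAt_log ht0).ofReal_comp).div_const s).sub_const (1 / s ^ 2)
    convert! h1.mul h2 using 1
    have e : (t : ℂ) ^ s = (t : ℂ) ^ (s - 1) * t := by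
      rw [Complex.cpow_sub _ _ ht0', Complex.cpow_one]
      field_simp
    rw [e]
    push_cast
    field_simp
    ring
  have hnorm : ∀ t : ℝ, 0 < t → ‖(t : ℂ) ^ (s - 1)‖ = t ^ (s.re - 1) := by
    intro t ht
    rw [Complex.norm_cpow_eq_rpow_re_of_pos ht]
    simp
  have hint : IntegrableOn (fun t : ℝ => (t : ℂ) ^ (s - 1) * (Real.log t : ℂ)) (Set.Ioi 1) := by
    refine (integrableOn_rpow_mul_log hs).mono' (by fun_prop) ?_
    filter_upwards [ae_restrict_mem measurableSet_Ioi] with t ht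
    have ht : (1 : ℝ) < t := ht
    rw [norm_mul, hnorm t (by linarith), Complex.norm_real,
      Real.norm_of_nonneg (Real.log_nonneg ht.le)]
  have hlim : Filter.Tendsto (fun t : ℝ => (t : ℂ) ^ s * ((Real.log t : ℂ) / s - 1 / s ^ 2))
      Filter.atTop (nhds 0) := by
    have hp : Filter.Tendsto (fun t : ℝ => (t : ℂ) ^ s) Filter.atTop (nhds 0) := by
      rw [tendsto_zero_iff_norm_tendsto_zero]
      have h := tendsto_rpow_neg_atTop (y := -s.re) (by linarith)
      refine h.congr' ?_
      filter_upwards [Filter.eventually_gt_atTop 0] with t ht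
      rw [Complex.norm_cpow_eq_rpow_re_of_pos ht, neg_neg]
    have hl : Filter.Tendsto (fun t : ℝ => (t : ℂ) ^ s * (Real.log t : ℂ)) Filter.atTop
        (nhds 0) := by
      rw [tendsto_zero_iff_norm_tendsto_zero]
      refine (tendsto_rpow_mul_log_atTop hs).congr' ?_
      filter_upwards [Filter.eventually_ge_atTop 1] with t ht
      rw [norm_mul, Complex.norm_cpow_eq_rpow_re_of_pos (by linarith), Complex.norm_real,
        Real.norm_of_nonneg (Real.log_nonneg ht)]
    have h := (hl.div_const s).sub (hp.mul_const (1 / s ^ 2))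
    simp only [zero_div, zero_mul, sub_zero] at h
    refine h.congr fun t => ?_
    ring
  rw [integral_Ioi_of_hasDerivAt_of_tendsto' hderiv hint hlim]
  simp

/-- Fubini: the `x`-integral gives `Γ(w) t ^ (-w)`, and the remaining integral of `t ^ (i - w) log
t` over `t > 1` converges because `Re w > i + 1`. -/
theorem hasMellin_logLaplace (i : ℕ) {w : ℂ} (hw : (i : ℝ) + 1 < w.re) :
    HasMellin (fun x => (logLaplace i x : ℂ)) w (Complex.Gamma w / (w - (i + 1)) ^ 2) := by
  have hw0 : 0 < w.re := by
    have : (0 : ℝ) ≤ i := Nat.cast_nonneg i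
    linarith
  set F : ℝ → ℝ → ℂ := fun x t =>
    (x : ℂ) ^ (w - 1) * ((t ^ i * Real.log t * Real.exp (-(x * t)) : ℝ) : ℂ) with hF
  have hnorm : ∀ x t : ℝ, 0 < x → 1 < t → ‖F x t‖ =
      (t ^ i * Real.log t) * (x ^ (w.re - 1) * Real.exp (-(t * x))) := by
    intro x t hx ht
    have hlog := Real.log_nonneg ht.le
    have ht0 : 0 < t := by linarith
    rw [hF]
    simp only
    rw [norm_mul, Complex.norm_cpow_eq_rpow_re_of_pos hx, Complex.norm_real,
      Real.norm_of_nonneg (by positivity), Complex.sub_re, Complex.one_re, mul_comm x t]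
    ring
  have hmeas : Measurable (Function.uncurry F) := by
    unfold Function.uncurry
    rw [hF]
    fun_prop
  have hint : Integrable (Function.uncurry F)
      ((volume.restrict (Set.Ioi 0)).prod (volume.restrict (Set.Ioi 1))) := by
    rw [integrable_prod_iff' hmeas.aestronglyMeasurable]
    refine ⟨?_, ?_⟩
    · filter_upwards [ae_restrict_mem measurableSet_Ioi] with t ht
      have ht : (1 : ℝ) < t := ht
      refine ((integrableOn_rpow_mul_exp_neg_mul hw0 (show 0 < t by linarith)).const_mul
        (t ^ i * Real.log t)).mono'
        (hmeas.comp (measurable_id.prodMk measurable_const)).aestronglyMeasurable ?_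
      filter_upwards [ae_restrict_mem measurableSet_Ioi] with x hx
      exact (hnorm x t hx ht).le
    · have h := (integrableOn_rpow_mul_log (a := (i : ℝ) + 1 - w.re) (by linarith)).mul_const
        (Real.Gamma w.re)
      refine IntegrableOn.congr_fun h (fun t ht => ?_) measurableSet_Ioi
      have ht : (1 : ℝ) < t := ht
      have ht0 : 0 < t := by linarith
      have e : ∫ x in Set.Ioi (0 : ℝ), ‖Function.uncurry F (x, t)‖ = ∫ x in Set.Ioi (0 : ℝ),
          (t ^ i * Real.log t) * (x ^ (w.re - 1) * Real.exp (-(t * x))) :=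
        setIntegral_congr_fun measurableSet_Ioi fun x hx => hnorm x t hx ht
      rw [e, integral_const_mul, Real.integral_rpow_mul_exp_neg_mul_Ioi hw0 ht0, one_div,
        Real.inv_rpow ht0.le, ← Real.rpow_neg ht0.le, ← Real.rpow_natCast,
        show (i : ℝ) + 1 - w.re - 1 = i + -w.re by ring, Real.rpow_add ht0]
      ring
  have hinner : ∀ x : ℝ, ∫ t in Set.Ioi (1 : ℝ), F x t =
      (x : ℂ) ^ (w - 1) • (logLaplace i x : ℂ) := by
    intro x
    rw [hF]
    simp only
    rw [integral_const_mul, integral_complex_ofReal, smul_eq_mul, logLaplace]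
  refine ⟨?_, ?_⟩
  · have h := hint.integral_prod_left
    simp only [Function.uncurry] at h
    simp_rw [hinner] at h
    exact h
  · rw [mellin]
    simp_rw [← hinner]
    rw [integral_integral_swap hint]
    have houter : ∀ t ∈ Set.Ioi (1 : ℝ), ∫ x in Set.Ioi (0 : ℝ), F x t =
        Complex.Gamma w * ((t : ℂ) ^ (((i : ℂ) + 1 - w) - 1) * (Real.log t : ℂ)) := by
      intro t ht
      have ht0 : (0 : ℝ) < t := zero_lt_one.trans ht
      have ht0' : (t : ℂ) ≠ 0 := by exact_mod_cast ht0.ne'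
      have e : ∀ x : ℝ, F x t = ((t : ℂ) ^ i * (Real.log t : ℂ)) *
          ((x : ℂ) ^ (w - 1) * Complex.exp (-(t * x))) := by
        intro x
        rw [hF]
        push_cast
        rw [mul_comm (x : ℂ) t]
        ring
      simp_rw [e]
      rw [integral_const_mul, Complex.integral_cpow_mul_exp_neg_mul_Ioi hw0 ht0, one_div,
        Complex.inv_cpow _ _ (by rw [Complex.arg_ofReal_of_nonneg ht0.le]; exact pi_pos.ne),
        show (i : ℂ) + 1 - w - 1 = i - w by ring, Complex.cpow_sub _ _ ht0', Complex.cpow_natCast]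
      ring
    rw [setIntegral_congr_fun measurableSet_Ioi houter, integral_const_mul,
      integral_cpow_mul_log (by simpa using hw)]
    rw [show ((i : ℂ) + 1 - w) ^ 2 = (w - (i + 1)) ^ 2 by ring]
    ring

theorem continuousAt_logLaplace (i : ℕ) {x : ℝ} (hx : 0 < x) : ContinuousAt (logLaplace i) x := by
  unfold logLaplace
  refine continuousAt_of_dominated
    (bound := fun t => t ^ i * Real.log t * Real.exp (-(x / 2 * t))) ?_ ?_
    (integrableOn_pow_mul_log_mul_exp_neg_mul i (by positivity)) ?_
  · exact Filter.Eventually.of_forall fun y => by fun_prop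
  · filter_upwards [lt_mem_nhds (show x / 2 < x by linarith)] with y hy
    filter_upwards [ae_restrict_mem measurableSet_Ioi] with t ht
    have ht : (1 : ℝ) < t := ht
    have hlog := Real.log_nonneg ht.le
    rw [Real.norm_of_nonneg (by positivity)]
    gcongr
  · exact Filter.Eventually.of_forall fun t => by fun_prop

theorem norm_Gamma_le {w : ℂ} (hw : 0 < w.re) : ‖Complex.Gamma w‖ ≤ Real.Gamma w.re := by
  rw [Complex.Gamma_eq_integral hw, Complex.GammaIntegral, Real.Gamma_eq_integral hw]
  refine (norm_integral_le_integral_norm _).trans (le_of_eq ?_)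
  refine setIntegral_congr_fun measurableSet_Ioi fun x hx => ?_
  rw [norm_mul, Complex.norm_cpow_eq_rpow_re_of_pos hx, Complex.norm_real,
    Real.norm_of_nonneg (Real.exp_pos _).le]
  simp

/-- The squared denominator alone gives integrable decay; for `Γ` the bound `|Γ(σ + i y)| ≤ Γ(σ)`
suffices. -/
theorem verticalIntegrable_Gamma_div_sq {a σ : ℝ} (ha : 0 ≤ a) (hσ : a < σ) :
    Complex.VerticalIntegrable (fun w => Complex.Gamma w / (w - a) ^ 2) σ := by
  have hσ0 : 0 < σ := ha.trans_lt hσ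
  have hδ : 0 < σ - a := by linarith
  have hre : ∀ y : ℝ, ((σ : ℂ) + y * Complex.I).re = σ := by simp
  have hcont : Continuous fun y : ℝ =>
      Complex.Gamma (σ + y * Complex.I) / ((σ : ℂ) + y * Complex.I - a) ^ 2 := by
    refine Continuous.div ?_ (by fun_prop) ?_
    · refine continuous_iff_continuousAt.2 fun y => ?_
      refine ContinuousAt.comp (f := fun y : ℝ => (σ : ℂ) + y * Complex.I)
        (Complex.differentiableAt_Gamma _ fun m h => ?_).continuousAt (by fun_prop)
      have h1 := congrArg Complex.re h
      rw [hre] at h1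
      simp only [Complex.neg_re, Complex.natCast_re] at h1
      have : (0 : ℝ) ≤ m := Nat.cast_nonneg m
      linarith
    · intro y h
      have h1 := congrArg Complex.re (pow_eq_zero_iff two_ne_zero |>.1 h)
      simp at h1
      linarith
  refine (integrable_inv_one_add_sq.const_mul
    (Real.Gamma σ * (1 + 1 / (σ - a) ^ 2))).mono' hcont.aestronglyMeasurable ?_
  refine Filter.Eventually.of_forall fun y => ?_
  have hG := norm_Gamma_le (w := (σ : ℂ) + y * Complex.I) (by rw [hre]; exact hσ0)
  rw [hre] at hG
  have hsq : ‖(σ : ℂ) + y * Complex.I - a‖ ^ 2 = (σ - a) ^ 2 + y ^ 2 := by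
    rw [show (σ : ℂ) + y * Complex.I - a = ((σ - a : ℝ) : ℂ) + (y : ℂ) * Complex.I by
      push_cast; ring, Complex.sq_norm, Complex.normSq_add_mul_I]
  rw [norm_div, norm_pow, hsq, div_eq_mul_inv, mul_assoc]
  refine mul_le_mul hG ?_ (by positivity) (Real.Gamma_pos_of_pos hσ0).le
  rw [← div_eq_mul_inv, le_div_iff₀ (by positivity), inv_mul_le_iff₀ (by positivity)]
  have : ((σ - a) ^ 2 + y ^ 2) * (1 + 1 / (σ - a) ^ 2) =
      1 + y ^ 2 + ((σ - a) ^ 2 + y ^ 2 / (σ - a) ^ 2) := by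
    field_simp
    ring
  rw [this]
  have : 0 ≤ (σ - a) ^ 2 + y ^ 2 / (σ - a) ^ 2 := by positivity
  linarith

/-! ### Evaluation of the Meijer G-function -/

/-- The functional equation of `Γ` collapses each quotient `Γ(-1 - i - s) / Γ(-i - s)` to `1 / (-1 -
i - s)`. -/
theorem meijerGIntegrand_log (i : ℕ) (z : ℂ) {s : ℂ} (hs : s.re < -1 - i) :
    meijerGIntegrand 3 0 ![-(i : ℂ), -(i : ℂ)] ![0, -1 - (i : ℂ), -1 - (i : ℂ)] z s =
      z ^ s * (Complex.Gamma (-s) / (-s - (i + 1)) ^ 2) := by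
  have h1 : 0 < (-1 - (i : ℂ) - s).re := by
    simp
    linarith
  have h0 : (-1 - (i : ℂ) - s) ≠ 0 := by
    intro h
    simp [h] at h1
  have hG := Complex.Gamma_ne_zero_of_re_pos h1
  have h2 : Complex.Gamma (-(i : ℂ) - s) =
      (-1 - (i : ℂ) - s) * Complex.Gamma (-1 - (i : ℂ) - s) := by
    rw [← Complex.Gamma_add_one _ h0]
    congr 1
    ring
  have f3 : (Finset.univ.filter fun j : Fin 3 => j.val < 3) = Finset.univ := by decide
  have f3' : (Finset.univ.filter fun j : Fin 3 => 3 ≤ j.val) = ∅ := by decide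
  have f2 : (Finset.univ.filter fun j : Fin 2 => j.val < 0) = ∅ := by decide
  have f2' : (Finset.univ.filter fun j : Fin 2 => 0 ≤ j.val) = Finset.univ := by decide
  rw [meijerGIntegrand, f3, f3', f2, f2', Fin.prod_univ_three, Fin.prod_univ_two]
  simp only [Matrix.cons_val_zero, Matrix.cons_val_one, Matrix.cons_val, Finset.prod_empty, mul_one,
    one_mul, zero_sub]
  rw [h2, show -s - ((i : ℂ) + 1) = -1 - i - s by ring]
  field_simp

theorem meijerG_log (i : ℕ) {x : ℝ} (hx : 0 < x) :
    meijerG 3 0 ![-(i : ℂ), -(i : ℂ)] ![0, -1 - (i : ℂ), -1 - (i : ℂ)] (x : ℂ) =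
      logLaplace i x := by
  set a : Fin 2 → ℂ := ![-(i : ℂ), -(i : ℂ)] with ha
  set b : Fin 3 → ℂ := ![0, -1 - (i : ℂ), -1 - (i : ℂ)] with hb
  -- Proved for every separating line, because the definition of `meijerG` takes an unspecified one.
  have hline : ∀ c : ℝ, IsSeparating 3 0 a b c → meijerGLine 3 0 a b x c = logLaplace i x := by
    intro c hc
    have hc1 : c < -1 - i := by
      have := hc.1 1 (by decide)
      simpa [hb] using this
    have hσ : (i : ℝ) + 1 < -c := by linarith
    have hM : ∀ y : ℝ, mellin (fun x => (logLaplace i x : ℂ)) (((-c : ℝ) : ℂ) + y * Complex.I) =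
        Complex.Gamma (((-c : ℝ) : ℂ) + y * Complex.I) /
          (((-c : ℝ) : ℂ) + y * Complex.I - ((i + 1 : ℝ) : ℂ)) ^ 2 := by
      intro y
      rw [(hasMellin_logLaplace i (w := ((-c : ℝ) : ℂ) + y * Complex.I) (by simpa using hσ)).2]
      push_cast
      rfl
    have hinv := mellinInv_mellin_eq (-c) (fun x => (logLaplace i x : ℂ)) hx
      (hasMellin_logLaplace i (by simpa using hσ)).1
      ((verticalIntegrable_Gamma_div_sq (a := (i : ℝ) + 1) (by positivity) hσ).congr
        (Filter.Eventually.of_forall fun y => (hM y).symm))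
      (Complex.continuous_ofReal.continuousAt.comp (continuousAt_logLaplace i hx))
    -- Mellin inversion runs along `Re w = -c` with `w = -s`; hence the reflection of the
    -- integration variable.
    rw [← hinv, mellinInv, meijerGLine, ← integral_neg_eq_self, Complex.real_smul]
    congr 1
    · push_cast
      rfl
    · refine integral_congr_ae (Filter.Eventually.of_forall fun y => ?_)
      simp only
      rw [hM, ha, hb, meijerGIntegrand_log i _ (by simpa using hc1), smul_eq_mul]
      push_cast
      have e : -((c : ℂ) + -y * Complex.I) = -(c : ℂ) + y * Complex.I := by ring
      rw [e, show -(-(c : ℂ) + y * Complex.I) = (c : ℂ) + -y * Complex.I by ring]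
  have hex : ∃ c : ℝ, IsSeparating 3 0 a b c := by
    refine ⟨-2 - i, fun j _ => ?_, fun j hj => absurd hj (Nat.not_lt_zero _)⟩
    have hi : (0 : ℝ) ≤ i := Nat.cast_nonneg i
    have h0 : (-2 : ℝ) < i := by linarith
    fin_cases j <;> simp [hb, h0]
  rw [meijerG, dif_pos hex]
  exact hline _ hex.choose_spec

/-! ### The capacity term -/

theorem sum_choose_mul_logLaplace (n : ℕ) {x : ℝ} (hx : 0 < x) :
    ∑ i ∈ Finset.range (n + 1), (n.choose i : ℝ) * (-1) ^ (n - i) * logLaplace i x =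
      ∫ t in Set.Ioi (1 : ℝ), (t - 1) ^ n * Real.log t * Real.exp (-(x * t)) := by
  simp only [logLaplace, ← integral_const_mul]
  rw [← integral_finsetSum _ fun i _ => (integrableOn_pow_mul_log_mul_exp_neg_mul i hx).const_mul _]
  refine integral_congr_ae (Filter.Eventually.of_forall fun t => ?_)
  simp only
  rw [sub_eq_add_neg, add_pow, Finset.sum_mul, Finset.sum_mul]
  refine Finset.sum_congr rfl fun i _ => ?_
  ring

theorem integral_Ioi_one_sub_pow_mul_log (n : ℕ) {γ : ℝ} (hγ : 0 < γ) :
    ∫ t in Set.Ioi (1 : ℝ), (t - 1) ^ n * Real.log t * Real.exp (-(1 / γ * t)) =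
      γ ^ (n + 1) * Real.exp (-(1 / γ)) *
        ∫ x in Set.Ioi (0 : ℝ), x ^ n * Real.exp (-x) * Real.log (1 + γ * x) := by
  set g : ℝ → ℝ := fun t => (t - 1) ^ n * Real.log t * Real.exp (-(1 / γ * t)) with hg
  have h1 : ∫ t in Set.Ioi (1 : ℝ), g t = ∫ y in Set.Ioi (0 : ℝ), g (y + 1) := by
    have h := (measurePreserving_add_right (volume : Measure ℝ) 1).setIntegral_preimage_emb
      (measurableEmbedding_addRight 1) g (Set.Ioi 1)
    rw [← h]
    simp
  have h2 := integral_comp_mul_left_Ioi' (fun y => g (y + 1)) 0 hγ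
  rw [mul_zero] at h2
  rw [h1, ← h2, smul_eq_mul, ← integral_const_mul, ← integral_const_mul]
  refine setIntegral_congr_fun measurableSet_Ioi fun x _ => ?_
  simp only [hg]
  rw [show -(1 / γ * (γ * x + 1)) = -(1 / γ) + -x by field_simp; ring, Real.exp_add,
    add_comm (γ * x) 1]
  ring

theorem integrable_capacity_gammaMeasure (n : ℕ) {γ : ℝ} (hγ : 0 < γ) :
    Integrable (fun x => capacity (γ * x)) (gammaMeasure ((n + 1 : ℕ) : ℝ) 1) := by
  have h := (integrable_pow_gammaMeasure n 1).const_mul (γ / Real.log 2)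
  have h2 : 0 < Real.log 2 := Real.log_pos one_lt_two
  have hm : Measurable fun x => capacity (γ * x) := by
    unfold capacity Real.logb
    fun_prop
  refine h.mono' hm.aestronglyMeasurable ?_
  filter_upwards [ae_gammaMeasure_pos n] with x hx
  have h0 : 0 ≤ Real.log (1 + γ * x) := Real.log_nonneg (by nlinarith [mul_pos hγ hx])
  have h3 := Real.log_le_sub_one_of_pos (show 0 < 1 + γ * x by positivity)
  rw [capacity, Real.logb, Real.norm_of_nonneg (by positivity), pow_one, div_mul_eq_mul_div]
  gcongr
  linarith

theorem integral_capacity_gammaMeasure (n : ℕ) {γ : ℝ} (hγ : 0 < γ) :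
    ((∫ x, capacity (γ * x) ∂gammaMeasure ((n + 1 : ℕ) : ℝ) 1 : ℝ) : ℂ) = Phi γ (n + 1) := by
  have hlog : Real.log 2 ≠ 0 := (Real.log_pos one_lt_two).ne'
  have hf : (n.factorial : ℝ) ≠ 0 := Nat.cast_ne_zero.2 n.factorial_ne_zero
  have hsum : ∑ i ∈ Finset.range (n + 1), ((n + 1 - 1).choose i : ℂ) * (-1) ^ (n + 1 - 1 - i) *
      meijerG 3 0 ![-(i : ℂ), -(i : ℂ)] ![0, -1 - (i : ℂ), -1 - (i : ℂ)] ((1 / γ : ℝ) : ℂ) =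
      ((γ ^ (n + 1) * Real.exp (-(1 / γ)) *
        ∫ x in Set.Ioi (0 : ℝ), x ^ n * Real.exp (-x) * Real.log (1 + γ * x) : ℝ) : ℂ) := by
    rw [← integral_Ioi_one_sub_pow_mul_log n hγ, ← sum_choose_mul_logLaplace n (by positivity)]
    rw [Complex.ofReal_sum]
    refine Finset.sum_congr rfl fun i _ => ?_
    rw [meijerG_log i (by positivity : 0 < 1 / γ), Nat.add_sub_cancel]
    push_cast
    rfl
  rw [Phi, hsum, ← Complex.ofReal_mul]
  congr 1
  rw [integral_gammaMeasure_nat_succ, Nat.cast_add_one, Real.Gamma_nat_eq_factorial]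
  have e : ∀ x : ℝ, (x ^ n * Real.exp (-x) / n.factorial) • capacity (γ * x) =
      1 / (n.factorial * Real.log 2) * (x ^ n * Real.exp (-x) * Real.log (1 + γ * x)) := by
    intro x
    rw [capacity, Real.logb, smul_eq_mul]
    field_simp
  simp_rw [e]
  rw [integral_const_mul]
  generalize ∫ x in Set.Ioi (0 : ℝ), x ^ n * Real.exp (-x) * Real.log (1 + γ * x) = J
  rw [Real.exp_neg]
  field_simp

/-! ### The rate bound -/

theorem effSNR_pos {ρ φ : ℝ} (hρ : 0 < ρ) (hφ : 0 < φ) (hφ1 : φ ≤ 1) : 0 < effSNR ρ φ := by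
  have : 0 ≤ (1 - φ) * ρ := mul_nonneg (by linarith) hρ.le
  unfold effSNR
  positivity

theorem measurable_capacity_mul (γ : ℝ) : Measurable fun x => capacity (γ * x) := by
  unfold capacity Real.logb
  fun_prop

theorem measurable_rateLoss_mul (T : ℕ) (ε γ : ℝ) : Measurable fun x => rateLoss T ε (γ * x) := by
  simp only [rateLoss_eq]
  exact ((measurable_normDispersion.comp (measurable_const_mul γ)).sqrt).const_mul _

theorem integrable_rateLoss {α : Type*} [MeasurableSpace α] {μ : Measure α} [IsFiniteMeasure μ]
    (T : ℕ) (ε : ℝ) {f : α → ℝ} (hf : AEMeasurable f μ) :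
    Integrable (fun x => rateLoss T ε (f x)) μ := by
  simp only [rateLoss_eq]
  exact (integrable_sqrt_normDispersion hf).const_mul _

end UplinkTraining

theorem theorem1 :
    ∃ K : ℝ, ∀ (N T : ℕ) (P φ ε : ℝ) (σ2 : ℝ≥0) (Ω : Type*) [MeasurableSpace Ω]
      (μ : Measure Ω) [IsProbabilityMeasure μ]
      (hu e : Ω → EuclideanSpace ℂ (Fin N)) (u n : Ω → ℂ),
      1 ≤ N → 1 ≤ T → 0 < P → 0 < φ → φ ≤ 1 → 0 < ε → ε < 1 → 0 < σ2 →
      UplinkTraining.IsUplinkModel μ σ2 hu e u n →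
      ∀ γ : ℝ, γ = UplinkTraining.effSNR (P / σ2) φ →
      ∀ D : ℝ, D = ∫ ω, UplinkTraining.rateLoss T ε (γ * ‖hu ω‖ ^ 2) ∂μ →
        -- the SINR in terms of the effective SNR
        (∀ ω, UplinkTraining.sinr μ P φ hu e u n ω = γ * ‖hu ω‖ ^ 2) ∧
        Integrable (fun ω => UplinkTraining.capacity (γ * ‖hu ω‖ ^ 2)) μ ∧
        Integrable (fun ω => UplinkTraining.rateLoss T ε (γ * ‖hu ω‖ ^ 2)) μ ∧
        -- the capacity term is an expectation over a Gamma(N,1) variable, with exact value Φ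
        Integrable (fun x => UplinkTraining.capacity (γ * x)) (gammaMeasure N 1) ∧
        ∫ ω, UplinkTraining.capacity (γ * ‖hu ω‖ ^ 2) ∂μ =
          ∫ x, UplinkTraining.capacity (γ * x) ∂(gammaMeasure N 1) ∧
        ((∫ x, UplinkTraining.capacity (γ * x) ∂(gammaMeasure N 1) : ℝ) : ℂ) =
          UplinkTraining.Phi γ N ∧
        -- the dispersion term is an expectation over a Gamma(N,1) variable
        D = ∫ x, UplinkTraining.rateLoss T ε (γ * x) ∂(gammaMeasure N 1) ∧
        -- the exact decomposition of the rate
        ((UplinkTraining.rateUplink μ P φ hu e u n T ε : ℝ) : ℂ) =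
          UplinkTraining.Phi γ N - (D : ℂ) ∧
        -- the Laplace approximation of the dispersion term, and so of the rate
        (2 ≤ N →
          |D - UplinkTraining.Psi γ N T ε| ≤ K / ((N : ℝ) - 1) * |UplinkTraining.Psi γ N T ε| ∧
          ‖((UplinkTraining.rateUplink μ P φ hu e u n T ε : ℝ) : ℂ) -
              (UplinkTraining.Phi γ N - (UplinkTraining.Psi γ N T ε : ℂ))‖ ≤
            K / ((N : ℝ) - 1) * |UplinkTraining.Psi γ N T ε|) := by
  -- The constant is that of `abs_integral_rateLoss_sub_Psi_le`. It serves both estimates: the rate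
  -- is exactly `Phi - D`, so both errors have the same absolute value.
  refine ⟨7, ?_⟩
  intro N T P φ ε σ2 Ω _ μ _ hu e u z hN _ hP hφ hφ1 _ _ hσ hmodel γ hγ D hD
  have hN0 : N ≠ 0 := Nat.one_le_iff_ne_zero.1 hN
  have hσ' : (0 : ℝ) < σ2 := hσ
  have hγ0 : 0 < γ := hγ ▸ UplinkTraining.effSNR_pos (div_pos hP hσ') hφ hφ1
  have hsinr : ∀ ω, UplinkTraining.sinr μ P φ hu e u z ω = γ * ‖hu ω‖ ^ 2 := fun ω => by
    rw [hγ, hmodel.sinr_eq hN0 hP hφ1 hσ]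
  have hlaw := hmodel.hasLaw_normSq hN0
  obtain ⟨n, rfl⟩ := Nat.exists_eq_succ_of_ne_zero hN0
  have hcapΓ := UplinkTraining.integrable_capacity_gammaMeasure n hγ0
  have hcapI : Integrable (fun ω => UplinkTraining.capacity (γ * ‖hu ω‖ ^ 2)) μ := by
    have h := hcapΓ
    rw [← hlaw.map_eq] at h
    exact h.comp_aemeasurable hlaw.aemeasurable
  have hlossI : Integrable (fun ω => UplinkTraining.rateLoss T ε (γ * ‖hu ω‖ ^ 2)) μ :=
    UplinkTraining.integrable_rateLoss T ε (hlaw.aemeasurable.const_mul γ)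
  have hcap : ∫ ω, UplinkTraining.capacity (γ * ‖hu ω‖ ^ 2) ∂μ =
      ∫ x, UplinkTraining.capacity (γ * x) ∂(gammaMeasure ((n + 1 : ℕ) : ℝ) 1) :=
    hlaw.integral_comp (UplinkTraining.measurable_capacity_mul γ).aestronglyMeasurable
  have hloss : D = ∫ x, UplinkTraining.rateLoss T ε (γ * x) ∂(gammaMeasure ((n + 1 : ℕ) : ℝ) 1) :=
    hD.trans (hlaw.integral_comp
      (UplinkTraining.measurable_rateLoss_mul T ε γ).aestronglyMeasurable)
  have hPhi := UplinkTraining.integral_capacity_gammaMeasure n hγ0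
  have hrate : ((UplinkTraining.rateUplink μ P φ hu e u z T ε : ℝ) : ℂ) =
      UplinkTraining.Phi γ (n + 1) - (D : ℂ) := by
    rw [UplinkTraining.rateUplink]
    simp only [hsinr]
    rw [integral_sub hcapI hlossI, hcap, ← hD, Complex.ofReal_sub, hPhi]
  refine ⟨hsinr, hcapI, hlossI, hcapΓ, hcap, hPhi, hloss, hrate, fun hN2 => ?_⟩
  have hn : n ≠ 0 := by omega
  have hbound := UplinkTraining.abs_integral_rateLoss_sub_Psi_le hn hγ0 T ε
  rw [← hloss] at hbound
  have hcast : (((n + 1 : ℕ) : ℝ)) - 1 = n := by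
    push_cast
    ring
  have hcast' : ((Nat.succ n : ℕ) : ℝ) - 1 = n := hcast
  rw [hcast']
  refine ⟨hbound, ?_⟩
  rw [hrate, sub_sub_sub_cancel_left, ← Complex.ofReal_sub, Complex.norm_real, Real.norm_eq_abs,
    abs_sub_comm]
  exact hbound
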